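/- **Setting.** Let $p\ge 2$ and $1/p+1/p^*=1$. For a real Banach space $E$, let $J_p^E(x)=\{\xi\in E^*:\langle\xi,x\rangle=\|x\|\,\|\xi\|,\ \|\xi\|=\|x\|^{p-1}\}$ be the duality map. $E$ is $p$-convex if, for some $K>0$, $\delta_E(\tau):=\inf\{1-\tfrac12\|z+w\|:\|z\|=\|w\|=1,\|z-w\|\ge\tau\}\ge K\tau^p$ for all $\tau\in(0,2]$. $E$ is uniformly smooth if $\rho_E(\tau)/\tau\to0$ as $\tau\searrow0$, where $\rho_E(\tau):=\sup\{\tfrac12(\|z+\tau w\|+\|z-\tau w\|)-1:\|z\|=\|w\|=1\}$. If $J_p^E$ is single-valued (for example if $E$ is uniformly smooth), the Bregman distance is $D_p(z,w)=\frac1{p^*}\|z\|^p+\frac1p\|w\|^p-\langle J_p^E(z),w\rangle$. Let $\mathcal X$ be a $p$-convex and uniformly smooth real Banach space. Let $\mathcal Y_1,\dots,\mathcal Y_N$ ($N\ge1$) be uniformly smooth real Banach spaces (for example all equal to one space $\mathcal Y$), and equip their product with the $\ell^r$ norm for some $r\in[1,\infty]$. Let $\mathbf A=(\mathbf A_1,\dots,\mathbf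 A_N):\mathcal X\to\prod_i\mathcal Y_i$ be bounded and linear, let $L_{\max}=\max_i\|\mathbf A_i\|$, let $y=(y_i)_i$ be exact data, and let $x^\dagger$ be the minimum norm solution of $\mathbf Ax=y$, i.e. $\mathbf Ax^\dagger=y$ and $\|x^\dagger\|=\inf\{\|x\|:\mathbf Ax=y\}$. For every $\delta>0$ let $y^\delta$ be noisy data with $\|y^\delta-y\|\le\delta$. Let $G_{p^*}$ be the smallest constant $G$ such that $D_{p^*}(z^*,w^*)\le\frac{G}{p^*}\|w^*-z^*\|^{p^*}$ for all $z^*,w^*\in\mathcal X^*$. Let $i_1,i_2,\dots$ be independent random indices, uniformly distributed on $\{1,\dots,N\}$, and let $\mu_k>0$ ($k\ge1$) be step sizes. Let $x_0\in\mathcal X$ be an initial guess with $J_p^{\mathcal X}(x_0)\in\overline{\operatorname{range}(\mathbf A^*)}$. The noisy SGD iterates are $x_0^\delta=x_0$ and $$x_{k+1}^\delta=J_{p^*}^{\mathcal X^*}\Big(J_p^{\mathcal X}(x_k^\delta)-\mu_{k+1}\,\mathbf A_{i_{k+1}}^*J_p^{\mathcal Y_{i_{k+1}}}\big(\mathbf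 A_{i_{k+1}}x_k^\delta-y_{i_{k+1}}^\delta\big)\Big),\qquad k\ge0,$$ where $\mathcal X^{**}$ is identified with $\mathcal X$. **Theorem.** Assume $\sum_{k\ge1}\mu_k=\infty$, $\sum_{k\ge1}\mu_k^{p^*}<\infty$ and, for some constant $C$, $1-L_{\max}^{p^*}\frac{G_{p^*}}{p^*}\mu_k^{p^*-1}>C>0$ for all $k\ge1$. If the (deterministic) stopping indices $k(\delta)\in\mathbb N$ satisfy $\lim_{\delta\searrow0}k(\delta)=\infty$ and $\lim_{\delta\searrow0}\delta^p\sum_{\ell=1}^{k(\delta)}\mu_\ell=0$, then $D_p(x^\delta_{k(\delta)},x^\dagger)$ is integrable for every $\delta>0$ and $$\lim_{\delta\searrow0}\mathbb E\big[D_p(x_{k(\delta)}^\delta,x^\dagger)\big]=0,$$ where the expectation is over the random indices. -/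

import Mathlib

open MeasureTheory ProbabilityTheory Filter Topology
open scoped ENNReal

noncomputable section

namespace BanachSGD

/-! ### Geometry of Banach spaces -/

section Geometry

variable (E : Type*) [NormedAddCommGroup E] [NormedSpace ℝ E]

/-- The modulus of convexity
`δ_E(τ) = inf {1 - ‖z + w‖ / 2 : ‖z‖ = ‖w‖ = 1, ‖z - w‖ ≥ τ}`, for `0 < τ ≤ 2`.
It is `EReal`-valued so that the infimum of the empty set (the zero space) is `+∞`. -/
def convexityModulus (τ : ℝ) : EReal :=
  ⨅ (z : E) (w : E) (_ : ‖z‖ = 1) (_ : ‖w‖ = 1) (_ : τ ≤ ‖z - w‖),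
    ((1 - ‖z + w‖ / 2 : ℝ) : EReal)

/-- `E` is `p`-convex: `δ_E(τ) ≥ K τ ^ p` for some `K > 0` and all `τ ∈ (0, 2]`. -/
def IsPConvex (p : ℝ) : Prop :=
  ∃ K : ℝ, 0 < K ∧ ∀ τ ∈ Set.Ioc (0 : ℝ) 2, ((K * τ ^ p : ℝ) : EReal) ≤ convexityModulus E τ

/-- The modulus of smoothness
`ρ_E(τ) = sup {(‖z + τ w‖ + ‖z - τ w‖) / 2 - 1 : ‖z‖ = ‖w‖ = 1}`
(the set is bounded above by `|τ|`). -/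
def smoothnessModulus (τ : ℝ) : ℝ :=
  sSup {t : ℝ | ∃ z w : E, ‖z‖ = 1 ∧ ‖w‖ = 1 ∧ t = (‖z + τ • w‖ + ‖z - τ • w‖) / 2 - 1}

/-- `E` is uniformly smooth: `ρ_E(τ) / τ → 0` as `τ ↘ 0`. -/
def IsUniformlySmooth : Prop :=
  Tendsto (fun τ : ℝ => smoothnessModulus E τ / τ) (𝓝[>] 0) (𝓝 0)

end Geometry

section Duality

variable {E : Type*} [NormedAddCommGroup E] [NormedSpace ℝ E]

/-- The (set-valued) duality map `J_p` of `E` with gauge `t ↦ t ^ (p - 1)`. -/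
def dualityMap (p : ℝ) (x : E) : Set (StrongDual ℝ E) :=
  {ξ | ξ x = ‖x‖ * ‖ξ‖ ∧ ‖x‖ ^ (p - 1) = ‖ξ‖}

/-- A single-valued selection `j_p` of the duality map. If `E` is smooth, then `J_p(x)` is a
singleton for every `x`, and this is its element. -/
def dualitySel (p : ℝ) (x : E) : StrongDual ℝ E :=
  Classical.epsilon fun ξ => ξ ∈ dualityMap p x

/-- The values of the duality map are non-empty, so that `dualitySel` is indeed a selection. -/
theorem dualitySel_mem {p : ℝ} (hp : 1 < p) (x : E) : dualitySel p x ∈ dualityMap p x := by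
  refine Classical.epsilon_spec (p := fun ξ => ξ ∈ dualityMap p x) ?_
  rcases eq_or_ne x 0 with rfl | hx
  · exact ⟨0, by simp, by simp [Real.zero_rpow (sub_pos.2 hp).ne']⟩
  · obtain ⟨g, hg, hgx⟩ := exists_dual_vector ℝ x (norm_ne_zero_iff.2 hx)
    have h0 : 0 ≤ ‖x‖ ^ (p - 1) := Real.rpow_nonneg (norm_nonneg x) _
    have hn : ‖(‖x‖ ^ (p - 1)) • g‖ = ‖x‖ ^ (p - 1) := by
      rw [norm_smul, hg, mul_one, Real.norm_of_nonneg h0]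
    refine ⟨(‖x‖ ^ (p - 1)) • g, ?_, hn.symm⟩
    rw [hn]
    simp only [smul_apply, hgx, smul_eq_mul]
    exact mul_comm _ _

/-- The duality map `J_q` of the dual space `E*`, read as a map `E* → E` through the canonical
embedding of `E` into its bidual: the element `x` of `E` whose canonical image in `E**` belongs
to `J_q(ξ)`. -/
def predualSel (q : ℝ) (ξ : StrongDual ℝ E) : E :=
  Classical.epsilon fun x => NormedSpace.inclusionInDoubleDual ℝ E x ∈ dualityMap q ξ

/-- The Bregman distance `D_p(z, w) = ‖z‖ ^ p / p* + ‖w‖ ^ p / p - ⟨J_p(z), w⟩`, where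
`p* = p / (p - 1)`. -/
def bregman (p : ℝ) (z w : E) : ℝ :=
  ‖z‖ ^ p / Real.conjExponent p + ‖w‖ ^ p / p - dualitySel p z w

end Duality

/-- The smallest constant `G` such that `D_q(z, w) ≤ (G / q) ‖w - z‖ ^ q` for all `z, w` in
the space `E`. -/
def bregmanConst (E : Type*) [NormedAddCommGroup E] [NormedSpace ℝ E] (q : ℝ) : ℝ :=
  sInf {G : ℝ | 0 < G ∧ ∀ z w : E, bregman q z w ≤ G / q * ‖w - z‖ ^ q}

/-! ### The Kaczmarz model and stochastic gradient descent -/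

section SGD

variable {X : Type*} [NormedAddCommGroup X] [NormedSpace ℝ X]

/-- `x` is a minimum norm solution of the equation `A x = y`. -/
def IsMinNormSolution {Z : Type*} [NormedAddCommGroup Z] [NormedSpace ℝ Z]
    (A : X →L[ℝ] Z) (y : Z) (x : X) : Prop :=
  A x = y ∧ ‖x‖ = sInf {t : ℝ | ∃ x' : X, A x' = y ∧ t = ‖x'‖}

/-- The range of the adjoint operator `A* : Z* → X*`, `φ ↦ φ ∘ A`. -/
def adjointRange {Z : Type*} [NormedAddCommGroup Z] [NormedSpace ℝ Z]
    (A : X →L[ℝ] Z) : Set (StrongDual ℝ X) :=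
  Set.range fun φ : StrongDual ℝ Z => φ.comp A

variable {N : ℕ} {Y : Fin N → Type*} [∀ i, NormedAddCommGroup (Y i)] [∀ i, NormedSpace ℝ (Y i)]
  {r : ℝ≥0∞} [Fact (1 ≤ r)]

/-- The `i`-th component `A_i : X → Y_i` of an operator `A` into the `ℓ^r` product of the
spaces `Y_1, …, Y_N`. -/
def component (A : X →L[ℝ] PiLp r Y) (i : Fin N) : X →L[ℝ] Y i :=
  (PiLp.proj (𝕜 := ℝ) r Y i).comp A

/-- `L_max = max_i ‖A_i‖`. -/
def Lmax (A : X →L[ℝ] PiLp r Y) : ℝ := ⨆ i : Fin N, ‖component A i‖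

/-- The update direction `g(x, y, i) = A_i* j_p(A_i x - y_i)`. -/
def direction (p : ℝ) (A : X →L[ℝ] PiLp r Y) (x : X) (y : PiLp r Y) (i : Fin N) :
    StrongDual ℝ X :=
  (dualitySel p (component A i x - y i)).comp (component A i)

/-- The SGD iterates `x_{k+1} = J_q^{X*}(J_p(x_k) - μ_{k+1} g(x_k, y, i_{k+1}))` for the data `y`,
started at `x₀`, along the path `s = (i_1, i_2, …)` of indices (`s 0` is not used). -/
def iterate (p q : ℝ) (A : X →L[ℝ] PiLp r Y) (y : PiLp r Y) (μ : ℕ → ℝ) (x₀ : X)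
    (s : ℕ → Fin N) : ℕ → X
  | 0 => x₀
  | k + 1 => predualSel q
      (dualitySel p (iterate p q A y μ x₀ s k)
        - μ (k + 1) • direction p A (iterate p q A y μ x₀ s k) y (s (k + 1)))

end SGD

end BanachSGD

end

/-!
Along a path of indices the dual variables `ξ_k = J_p(x_k)` are additive,
`ξ_{k+1} = ξ_k - μ_{k+1} A_i* j_p(A_i x_k - y_i)`, so the argument is carried out for the Fenchel
gap `‖ξ‖ ^ q / q + ‖w‖ ^ p / p - ⟨ξ, w⟩` (`fenchelGap`), which equals `D_p(x, w)` for `ξ = J_p(x)`.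

*Geometry.* The modulus of convexity gives a midpoint inequality for `‖·‖ ^ p`
(`IsPConvex.exists_midpoint_rpow_le`), hence `c ‖x - w‖ ^ p ≤ D_p(x, w)`. From this inequality
follow the existence and continuity of the inverse duality map, the `q`-smoothness of the dual space
and reflexivity (`IsPConvex.surjective_inclusionInDoubleDual`), and so the constant `bregmanConst`
is an infimum over a non-empty set and is attained. Uniform smoothness makes the duality map
single-valued and continuous.

*Pathwise estimates.* One step changes the Bregman distance to an exact solution by at most
`-C μ ‖ρ‖ ^ p + μ δ ‖ρ‖ ^ (p - 1)`, where `ρ` is the sampled residual (`bregman_step_le`). Hence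
for exact data the distance decreases and `∑ μ ‖ρ‖ ^ p` is bounded, while for noisy data the
distance grows by at most a constant times `δ ^ p ∑ μ`.

*Exact data.* Write `S_n` for the sum of the first `n` step sizes, and let `x†` be the minimum norm
solution. Then `D_p(x_n, x†) ≤ ⟨ξ_n - J_p(x†), x_n - x†⟩`, and `J_p(x†)` lies in the closure of the
range of `A*`, as does `ξ_0`. So `ξ_n - J_p(x†)` is the sum of the updates, whose weights add up to
`O(S_n ^ (1 / p))` by Hölder's inequality, plus a fixed element of the range, plus a small error;
this bounds `D_p(x_n, x†)` by a multiple of `S_n ^ (1 / p)` times the residual of `x_n`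
(`exists_bregman_iterate_le`). Because the next index is uniform and independent of the past,
`∑ μ_{k+1} E‖A x_k - y‖ ^ p` converges; since `∑ μ_{k+1} / S_k` diverges, `S_k E‖A x_k - y‖ ^ p`
becomes arbitrarily small (`exists_sum_mul_lt`), and with it `E D_p(x_k, x†)`.

*Noisy data.* Fix `m` with `E D_p(x_m, x†)` small. The expectation at time `m` is a finite sum over
index paths, along each of which the iterate depends continuously on the data, so it stays small
for the data `y^δ` once `δ` is small. From `m` to `k(δ)` the distance grows by at most a multiple of
`δ ^ p S_{k(δ)}`, which tends to `0`.
-/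

noncomputable section

namespace BanachSGD

/-! ### Power-type uniform convexity -/

/-- The scalar form of Clarkson's inequality for `p ≥ 2`. -/
theorem two_mul_add_rpow_le {p a b : ℝ} (hp : 2 ≤ p) (hb : 0 ≤ b) (hab : b ≤ a) :
    2 * (a ^ p + b ^ p) ≤ (a + b) ^ p + (a - b) ^ p := by
  have hp2 : 1 ≤ p / 2 := by linarith
  have ha : 0 ≤ a := hb.trans hab
  have hsq : ∀ t : ℝ, 0 ≤ t → t ^ p = (t ^ 2) ^ (p / 2) := fun t ht => by
    rw [← Real.rpow_natCast, ← Real.rpow_mul ht]; congr 1; push_cast; ring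
  have h1 := Real.add_rpow_le_rpow_add (sq_nonneg a) (sq_nonneg b) hp2
  have h2 := (convexOn_rpow hp2).2 (Set.mem_Ici.2 (sq_nonneg (a + b)))
    (Set.mem_Ici.2 (sq_nonneg (a - b))) (show (0 : ℝ) ≤ 1 / 2 by norm_num)
    (show (0 : ℝ) ≤ 1 / 2 by norm_num) (by norm_num)
  simp only [smul_eq_mul] at h2
  rw [show 1 / 2 * (a + b) ^ 2 + 1 / 2 * (a - b) ^ 2 = a ^ 2 + b ^ 2 by ring] at h2
  rw [hsq a ha, hsq b hb, hsq (a + b) (by linarith), hsq (a - b) (by linarith)]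
  linarith

section UniformConvexity

variable {E : Type*} [NormedAddCommGroup E] [NormedSpace ℝ E]

theorem IsPConvex.exists_norm_add_le {p : ℝ} (hp : 0 < p) (hE : IsPConvex E p) :
    ∃ K > 0, ∀ z w : E, ‖z‖ = 1 → ‖w‖ = 1 → ‖z + w‖ / 2 ≤ 1 - K * ‖z - w‖ ^ p := by
  obtain ⟨K, hK, h⟩ := hE
  refine ⟨K, hK, fun z w hz hw => ?_⟩
  rcases eq_or_ne z w with rfl | hne
  · have : ‖z + z‖ = 2 := by rw [← two_smul ℝ, norm_smul, hz]; norm_num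
    simp [this, Real.zero_rpow hp.ne']
  · have hpos : 0 < ‖z - w‖ := norm_pos_iff.2 (sub_ne_zero.2 hne)
    have hle : ‖z - w‖ ≤ 2 := (norm_sub_le z w).trans (by rw [hz, hw]; norm_num)
    have h1 := h _ ⟨hpos, hle⟩
    have h2 : convexityModulus E ‖z - w‖ ≤ ((1 - ‖z + w‖ / 2 : ℝ) : EReal) :=
      iInf₂_le_of_le z w <| iInf₂_le_of_le hz hw <| iInf_le_of_le le_rfl le_rfl
    have h3 := EReal.coe_le_coe_iff.1 (h1.trans h2)
    linarith

/-- The midpoint inequality for a unit vector `x` and a vector `s • u` on a shorter sphere. The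
gap is the sum of two contributions: that of the difference `1 - s` of the norms, by Clarkson's
inequality, and that of the angle between `x` and `u`, by the modulus of convexity. -/
theorem midpoint_rpow_le_of_unit {p K : ℝ} (hp : 2 ≤ p) (hK : 0 < K)
    (h : ∀ z w : E, ‖z‖ = 1 → ‖w‖ = 1 → ‖z + w‖ / 2 ≤ 1 - K * ‖z - w‖ ^ p)
    {x u : E} (hx : ‖x‖ = 1) (hu : ‖u‖ = 1) {s : ℝ} (hs0 : 0 ≤ s) (hs1 : s ≤ 1) :
    (‖x + s • u‖ / 2) ^ p ≤ (1 + s ^ p) / 2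
      - min 1 K * (1 / 4) ^ p * ‖x - s • u‖ ^ p := by
  set t := ‖x - u‖
  have ht0 : 0 ≤ t := norm_nonneg _
  set a := (1 + s) / 2 with ha
  set b := (1 - s) / 2 with hb
  set e := s * (K * t ^ p) with he
  have htp : 0 ≤ t ^ p := Real.rpow_nonneg ht0 p
  have hbp : 0 ≤ b ^ p := Real.rpow_nonneg (by rw [hb]; linarith) p
  have he0 : 0 ≤ e := by positivity
  have hmid : ‖x + s • u‖ / 2 ≤ a - e := by
    have h1 : ‖x + s • u‖ ≤ s * ‖x + u‖ + (1 - s) := by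
      calc ‖x + s • u‖ = ‖s • (x + u) + (1 - s) • x‖ := by congr 1; module
        _ ≤ ‖s • (x + u)‖ + ‖(1 - s) • x‖ := norm_add_le _ _
        _ = _ := by
          rw [norm_smul, norm_smul, hx, Real.norm_of_nonneg hs0,
            Real.norm_of_nonneg (by linarith), mul_one]
    have h2 := mul_le_mul_of_nonneg_left (h x u hx hu) hs0
    rw [ha, he]
    linarith
  have hae : 0 ≤ a - e := le_trans (by positivity) hmid
  have ha0 : 0 < a := by rw [ha]; linarith
  have hclark := two_mul_add_rpow_le (a := a) (b := b) hp (by rw [hb]; linarith)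
    (by rw [ha, hb]; linarith)
  rw [show a + b = 1 by rw [ha, hb]; ring, show a - b = s by rw [ha, hb]; ring,
    Real.one_rpow] at hclark
  -- `(a - e) ^ p ≤ a ^ (p - 1) * (a - e) = a ^ p - a ^ (p - 1) * e`, and `a ≥ 1 / 2`.
  have hpow : (‖x + s • u‖ / 2) ^ p ≤ a ^ p - (1 / 2) ^ p * e := by
    have h1 : (‖x + s • u‖ / 2) ^ p ≤ (a - e) ^ p :=
      Real.rpow_le_rpow (by positivity) hmid (by linarith)
    have h2 : (a - e) ^ p ≤ a ^ (p - 1) * (a - e) := by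
      calc (a - e) ^ p = (a - e) ^ (p - 1) * (a - e) := by
            rw [← Real.rpow_add_one' hae (by linarith)]; congr 1; ring
        _ ≤ _ := by
          gcongr
          · linarith
          · linarith
    have h3 : a ^ (p - 1) * a = a ^ p := by
      rw [← Real.rpow_add_one' ha0.le (by linarith)]; congr 1; ring
    have h4 : (1 / 2 : ℝ) ^ p ≤ a ^ (p - 1) :=
      (Real.rpow_le_rpow_of_exponent_ge (by norm_num) (by norm_num) (by linarith)).trans
        (Real.rpow_le_rpow (by norm_num) (by rw [ha]; linarith) (by linarith))
    have h5 := mul_le_mul_of_nonneg_right h4 he0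
    linarith
  have hdist : ‖x - s • u‖ ^ p ≤ 2 ^ p * (s * t ^ p + 2 ^ p * b ^ p) := by
    have h1 : ‖x - s • u‖ ≤ s * t + 2 * b := by
      calc ‖x - s • u‖ = ‖s • (x - u) + (1 - s) • x‖ := by congr 1; module
        _ ≤ ‖s • (x - u)‖ + ‖(1 - s) • x‖ := norm_add_le _ _
        _ = s * t + (1 - s) := by
          rw [norm_smul, norm_smul, hx, Real.norm_of_nonneg hs0,
            Real.norm_of_nonneg (by linarith), mul_one]
        _ = _ := by rw [hb]; ring
    have hst : 0 ≤ s * t := by positivity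
    have hb0 : 0 ≤ 2 * b := by rw [hb]; linarith
    have h2 : ((s * t) + 2 * b) ^ p ≤ 2 ^ p * ((s * t) ^ p + (2 * b) ^ p) := by
      have hmax : (s * t) + 2 * b ≤ 2 * max (s * t) (2 * b) := by
        linarith [le_max_left (s * t) (2 * b), le_max_right (s * t) (2 * b)]
      have hmax0 : 0 ≤ max (s * t) (2 * b) := le_max_of_le_left hst
      calc ((s * t) + 2 * b) ^ p ≤ (2 * max (s * t) (2 * b)) ^ p :=
            Real.rpow_le_rpow (by positivity) hmax (by linarith)
        _ = 2 ^ p * max (s * t) (2 * b) ^ p := Real.mul_rpow (by norm_num) hmax0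
        _ ≤ _ := by
          gcongr
          rcases max_cases (s * t) (2 * b) with ⟨h, -⟩ | ⟨h, -⟩ <;> rw [h]
          · linarith [Real.rpow_nonneg hb0 p]
          · linarith [Real.rpow_nonneg hst p]
    have h3 : (s * t) ^ p ≤ s * t ^ p := by
      rw [Real.mul_rpow hs0 ht0]
      gcongr
      calc s ^ p ≤ s ^ (1 : ℝ) :=
            Real.rpow_le_rpow_of_exponent_ge' hs0 hs1 (by norm_num) (by linarith)
        _ = s := Real.rpow_one s
    rw [Real.mul_rpow (by norm_num) (by rw [hb]; linarith : (0 : ℝ) ≤ b)] at h2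
    calc _ ≤ _ := Real.rpow_le_rpow (norm_nonneg _) h1 (by linarith)
      _ ≤ _ := h2
      _ ≤ _ := by gcongr
  have hm1 : min 1 K ≤ 1 := min_le_left _ _
  have hm2 : min 1 K ≤ K := min_le_right _ _
  have hm0 : 0 < min 1 K := lt_min one_pos hK
  have h42 : (1 / 4 : ℝ) ^ p * 2 ^ p = (1 / 2) ^ p := by
    rw [← Real.mul_rpow (by norm_num) (by norm_num)]; norm_num
  have h22 : (1 / 2 : ℝ) ^ p * 2 ^ p = 1 := by
    rw [← Real.mul_rpow (by norm_num) (by norm_num)]; norm_num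
  have hfin : min 1 K * (1 / 4) ^ p * ‖x - s • u‖ ^ p ≤ (1 / 2) ^ p * e + b ^ p := by
    calc min 1 K * (1 / 4) ^ p * ‖x - s • u‖ ^ p
        ≤ min 1 K * (1 / 4) ^ p * (2 ^ p * (s * t ^ p + 2 ^ p * b ^ p)) := by gcongr
      _ = min 1 K * ((1 / 4) ^ p * 2 ^ p) * (s * t ^ p + 2 ^ p * b ^ p) := by ring
      _ = (1 / 2) ^ p * (s * (min 1 K * t ^ p))
          + min 1 K * (((1 / 2) ^ p * 2 ^ p) * b ^ p) := by rw [h42]; ring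
      _ ≤ (1 / 2) ^ p * (s * (K * t ^ p)) + 1 * (((1 / 2) ^ p * 2 ^ p) * b ^ p) := by gcongr
      _ = _ := by rw [h22, he]; ring
  linarith

/-- In a `p`-convex space, `‖·‖ ^ p` is uniformly convex with modulus of power type `p`. -/
theorem IsPConvex.exists_midpoint_rpow_le {p : ℝ} (hp : 2 ≤ p) (hE : IsPConvex E p) :
    ∃ c > 0, ∀ x w : E, (‖x + w‖ / 2) ^ p ≤ (‖x‖ ^ p + ‖w‖ ^ p) / 2 - c * ‖x - w‖ ^ p := by
  obtain ⟨K, hK, h⟩ := hE.exists_norm_add_le (by linarith)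
  refine ⟨min 1 K * (1 / 4) ^ p, by positivity, ?_⟩
  have main : ∀ x w : E, ‖w‖ ≤ ‖x‖ → (‖x + w‖ / 2) ^ p ≤
      (‖x‖ ^ p + ‖w‖ ^ p) / 2 - min 1 K * (1 / 4) ^ p * ‖x - w‖ ^ p := by
    intro x w hwx
    rcases eq_or_ne x 0 with rfl | hx
    · have hw : w = 0 := by simpa using hwx
      simp [hw, Real.zero_rpow (by linarith : p ≠ 0)]
    have hxn : 0 < ‖x‖ := norm_pos_iff.2 hx
    have hunit : ‖‖x‖⁻¹ • x‖ = 1 := norm_smul_inv_norm (𝕜 := ℝ) hx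
    have hxx : ‖x‖ • (‖x‖⁻¹ • x) = x := smul_inv_smul₀ hxn.ne' x
    obtain ⟨u, hu, hwu⟩ : ∃ u : E, ‖u‖ = 1 ∧ w = ‖w‖ • u := by
      rcases eq_or_ne w 0 with rfl | hw
      · exact ⟨_, hunit, by simp⟩
      · exact ⟨‖w‖⁻¹ • w, norm_smul_inv_norm (𝕜 := ℝ) hw,
          (smul_inv_smul₀ (norm_ne_zero_iff.2 hw) w).symm⟩
    have hww : w = ‖x‖ • ((‖w‖ / ‖x‖) • u) := by
      rw [smul_smul, mul_div_cancel₀ _ hxn.ne', ← hwu]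
    have key := midpoint_rpow_le_of_unit hp hK h hunit hu (s := ‖w‖ / ‖x‖)
      (by positivity) ((div_le_one hxn).2 hwx)
    have hadd : ‖x + w‖ = ‖x‖ * ‖‖x‖⁻¹ • x + (‖w‖ / ‖x‖) • u‖ := by
      rw [← norm_smul_of_nonneg hxn.le, smul_add, hxx, ← hww]
    have hsub : ‖x - w‖ = ‖x‖ * ‖‖x‖⁻¹ • x - (‖w‖ / ‖x‖) • u‖ := by
      rw [← norm_smul_of_nonneg hxn.le, smul_sub, hxx, ← hww]
    rw [hadd, hsub, mul_div_assoc, Real.mul_rpow hxn.le (by positivity),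
      Real.mul_rpow hxn.le (by positivity)]
    have hxp : 0 < ‖x‖ ^ p := by positivity
    have hdiv : ‖w‖ ^ p = ‖x‖ ^ p * (‖w‖ / ‖x‖) ^ p := by
      rw [← Real.mul_rpow hxn.le (by positivity), mul_div_cancel₀ _ hxn.ne']
    rw [hdiv]
    have := mul_le_mul_of_nonneg_left key hxp.le
    linarith
  intro x w
  rcases le_total ‖w‖ ‖x‖ with hwx | hwx
  · exact main x w hwx
  · have := main w x hwx
    rwa [add_comm w x, norm_sub_rev, add_comm (‖w‖ ^ p)] at this

end UniformConvexity

/-! ### The duality map and the Fenchel gap -/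

section Duality

variable {E : Type*} [NormedAddCommGroup E] [NormedSpace ℝ E] {p q : ℝ}

theorem mem_dualityMap_iff {x : E} {ξ : StrongDual ℝ E} :
    ξ ∈ dualityMap p x ↔ ξ x = ‖x‖ * ‖ξ‖ ∧ ‖x‖ ^ (p - 1) = ‖ξ‖ := Iff.rfl

theorem apply_self_of_mem_dualityMap (hpq : p.HolderConjugate q) {x : E} {ξ : StrongDual ℝ E}
    (h : ξ ∈ dualityMap p x) : ξ x = ‖x‖ ^ p := by
  rw [h.1, ← h.2, mul_comm, ← Real.rpow_add_one' (norm_nonneg x) (by simpa using hpq.ne_zero)]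
  congr 1; ring

theorem norm_rpow_of_mem_dualityMap (hpq : p.HolderConjugate q) {x : E} {ξ : StrongDual ℝ E}
    (h : ξ ∈ dualityMap p x) : ‖ξ‖ ^ q = ‖x‖ ^ p := by
  rw [← h.2, ← Real.rpow_mul (norm_nonneg x), hpq.sub_one_mul_conj]

/-- The Fenchel gap `‖ξ‖ ^ q / q + ‖w‖ ^ p / p - ⟨ξ, w⟩`, which is the Bregman distance
`D_p(z, w)` when `ξ = J_p(z)`. Unlike the Bregman distance it is a function of the dual variable,
in which the stochastic iteration is additive. -/
def fenchelGap (p q : ℝ) (ξ : StrongDual ℝ E) (w : E) : ℝ :=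
  ‖ξ‖ ^ q / q + ‖w‖ ^ p / p - ξ w

theorem fenchelGap_nonneg (hpq : p.HolderConjugate q) (ξ : StrongDual ℝ E) (w : E) :
    0 ≤ fenchelGap p q ξ w := by
  have h1 := Real.young_inequality_of_nonneg (norm_nonneg w) (norm_nonneg ξ) hpq
  have h2 : ξ w ≤ ‖ξ‖ * ‖w‖ := (le_abs_self _).trans (ξ.le_opNorm w)
  unfold fenchelGap
  linarith [mul_comm ‖w‖ ‖ξ‖]

theorem fenchelGap_eq_zero (hpq : p.HolderConjugate q) {x : E} {ξ : StrongDual ℝ E}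
    (h : ξ ∈ dualityMap p x) : fenchelGap p q ξ x = 0 := by
  rw [fenchelGap, norm_rpow_of_mem_dualityMap hpq h, apply_self_of_mem_dualityMap hpq h]
  have := hpq.inv_add_inv_eq_one
  linear_combination ‖x‖ ^ p * this

theorem bregman_eq_fenchelGap (hpq : p.HolderConjugate q) (z w : E) :
    bregman p z w = fenchelGap p q (dualitySel p z) w := by
  rw [bregman, fenchelGap, hpq.conjExponent_eq,
    norm_rpow_of_mem_dualityMap hpq (dualitySel_mem hpq.lt z)]

/-- The three-point identity of the Fenchel gap. -/
theorem fenchelGap_eq_add (hpq : p.HolderConjugate q) {x : E} {ξ : StrongDual ℝ E}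
    (h : ξ ∈ dualityMap p x) (η : StrongDual ℝ E) (w : E) :
    fenchelGap p q η w = fenchelGap p q ξ w + fenchelGap p q η x - (η - ξ) (w - x) := by
  have h0 := fenchelGap_eq_zero hpq h
  simp only [fenchelGap, map_sub, sub_apply] at *
  linarith

theorem fenchelGap_add_fenchelGap (hpq : p.HolderConjugate q) {x w : E} {ξ η : StrongDual ℝ E}
    (hx : ξ ∈ dualityMap p x) (hw : η ∈ dualityMap p w) :
    fenchelGap p q ξ w + fenchelGap p q η x = (ξ - η) (x - w) := by
  have := fenchelGap_eq_add hpq hx η w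
  rw [fenchelGap_eq_zero hpq hw] at this
  simp only [map_sub, sub_apply] at *
  linarith

/-- If the bidual element of `x` belongs to `J_q(ξ)`, then `ξ` belongs to `J_p(x)`. -/
theorem mem_dualityMap_of_inclusion_mem (hpq : p.HolderConjugate q) {x : E} {ξ : StrongDual ℝ E}
    (h : NormedSpace.inclusionInDoubleDual ℝ E x ∈ dualityMap q ξ) : ξ ∈ dualityMap p x := by
  have hn : ‖NormedSpace.inclusionInDoubleDual ℝ E x‖ = ‖x‖ :=
    (NormedSpace.inclusionInDoubleDualLi ℝ (E := E)).norm_map x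
  obtain ⟨h1, h2⟩ := h
  rw [hn] at h1 h2
  refine ⟨by rw [mul_comm]; exact h1, ?_⟩
  rw [← h2, ← Real.rpow_mul (norm_nonneg ξ)]
  have : (q - 1) * (p - 1) = 1 := by linear_combination hpq.mul_eq_add
  rw [this, Real.rpow_one]

theorem inclusion_mem_dualityMap (hpq : p.HolderConjugate q) {x : E} {ξ : StrongDual ℝ E}
    (h : ξ ∈ dualityMap p x) : NormedSpace.inclusionInDoubleDual ℝ E x ∈ dualityMap q ξ := by
  have hn : ‖NormedSpace.inclusionInDoubleDual ℝ E x‖ = ‖x‖ :=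
    (NormedSpace.inclusionInDoubleDualLi ℝ (E := E)).norm_map x
  obtain ⟨h1, h2⟩ := h
  refine mem_dualityMap_iff.2 ?_
  rw [hn]
  refine ⟨by rw [mul_comm]; exact h1, ?_⟩
  rw [← h2, ← Real.rpow_mul (norm_nonneg x)]
  have : (p - 1) * (q - 1) = 1 := by linear_combination hpq.mul_eq_add
  rw [this, Real.rpow_one]

end Duality

/-! ### Uniform smoothness and the continuity of the duality map -/

section Smooth

variable {E : Type*} [NormedAddCommGroup E] [NormedSpace ℝ E] {p q : ℝ}

theorem norm_add_norm_sub_le_smoothnessModulus {z w : E} (hz : ‖z‖ = 1) (hw : ‖w‖ = 1) (τ : ℝ) :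
    ‖z + τ • w‖ + ‖z - τ • w‖ ≤ 2 + 2 * smoothnessModulus E τ := by
  have h : (‖z + τ • w‖ + ‖z - τ • w‖) / 2 - 1 ≤ smoothnessModulus E τ := by
    refine le_csSup ⟨|τ|, ?_⟩ ⟨z, w, hz, hw, rfl⟩
    rintro t ⟨z, w, hz, hw, rfl⟩
    have h1 := norm_add_le z (τ • w)
    have h2 := norm_sub_le z (τ • w)
    rw [norm_smul, hz, hw, Real.norm_eq_abs] at h1 h2
    linarith
  linarith

/-- Norming functionals of unit vectors depend on the vector in a way controlled by the modulus
of smoothness: test the two functionals on `z + τ w` and `z - τ w`. -/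
theorem norm_sub_le_of_norming {z z' : E} (hz : ‖z‖ = 1) {f g : StrongDual ℝ E}
    (hf : ‖f‖ = 1) (hg : ‖g‖ = 1) (hfz : f z = 1) (hgz : g z' = 1) {τ : ℝ} (hτ : 0 < τ) :
    ‖g - f‖ ≤ 2 * (smoothnessModulus E τ / τ) + ‖z - z'‖ / τ := by
  have key : ∀ w : E, ‖w‖ = 1 →
      (g - f) w ≤ 2 * (smoothnessModulus E τ / τ) + ‖z - z'‖ / τ := by
    intro w hw
    have h1 := norm_add_norm_sub_le_smoothnessModulus hz hw τ
    have h2 : g (z + τ • w) ≤ ‖z + τ • w‖ := by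
      simpa [hg] using (le_abs_self _).trans (g.le_opNorm (z + τ • w))
    have h3 : f (z - τ • w) ≤ ‖z - τ • w‖ := by
      simpa [hf] using (le_abs_self _).trans (f.le_opNorm (z - τ • w))
    have h4 : g (z' - z) ≤ ‖z - z'‖ := by
      rw [norm_sub_rev]
      simpa [hg] using (le_abs_self _).trans (g.le_opNorm (z' - z))
    simp only [map_add, map_sub, map_smul, smul_eq_mul] at h2 h3 h4
    rw [← mul_div_assoc, ← add_div, le_div_iff₀ hτ, sub_apply]
    linarith
  have hnn : 0 ≤ 2 * (smoothnessModulus E τ / τ) + ‖z - z'‖ / τ := by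
    have h1 := key z hz
    have h2 := key (-z) (by rw [norm_neg, hz])
    rw [map_neg] at h2
    linarith
  refine ContinuousLinearMap.opNorm_le_of_unit_norm hnn fun w hw => ?_
  refine abs_le.2 ⟨?_, key w hw⟩
  have := key (-w) (by rw [norm_neg, hw])
  rw [map_neg] at this
  linarith

theorem norm_inv_smul_of_mem_dualityMap {x : E} (hx : x ≠ 0) {ξ : StrongDual ℝ E}
    (h : ξ ∈ dualityMap p x) : ‖‖ξ‖⁻¹ • ξ‖ = 1 ∧ (‖ξ‖⁻¹ • ξ) (‖x‖⁻¹ • x) = 1 := by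
  have hx' : 0 < ‖x‖ := norm_pos_iff.2 hx
  have hξ : 0 < ‖ξ‖ := h.2 ▸ Real.rpow_pos_of_pos hx' _
  refine ⟨norm_smul_inv_norm (𝕜 := ℝ) (norm_pos_iff.1 hξ), ?_⟩
  simp only [smul_apply, map_smul, smul_eq_mul, h.1]
  field_simp

theorem IsUniformlySmooth.eq_of_mem_dualityMap (hE : IsUniformlySmooth E) (hp : 1 < p) {x : E}
    {ξ η : StrongDual ℝ E} (hξ : ξ ∈ dualityMap p x) (hη : η ∈ dualityMap p x) : ξ = η := by
  rcases eq_or_ne x 0 with rfl | hx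
  · have h0 : (‖(0 : E)‖) ^ (p - 1) = 0 := by
      rw [norm_zero, Real.zero_rpow (sub_pos.2 hp).ne']
    rw [norm_eq_zero.1 (hξ.2.symm.trans h0), norm_eq_zero.1 (hη.2.symm.trans h0)]
  · have hnorm : ‖η‖ = ‖ξ‖ := hη.2.symm.trans hξ.2
    have hz : ‖‖x‖⁻¹ • x‖ = 1 := norm_smul_inv_norm (𝕜 := ℝ) hx
    obtain ⟨f1, f2⟩ := norm_inv_smul_of_mem_dualityMap hx hξ
    obtain ⟨g1, g2⟩ := norm_inv_smul_of_mem_dualityMap hx hη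
    have hlim : Tendsto (fun τ : ℝ => 2 * (smoothnessModulus E τ / τ)) (𝓝[>] 0) (𝓝 0) := by
      simpa using hE.const_mul 2
    have h0 : ‖‖η‖⁻¹ • η - ‖ξ‖⁻¹ • ξ‖ ≤ 0 := by
      refine ge_of_tendsto hlim ?_
      filter_upwards [self_mem_nhdsWithin] with τ hτ
      simpa using norm_sub_le_of_norming hz f1 g1 f2 g2 (Set.mem_Ioi.1 hτ)
    have h1 := sub_eq_zero.1 (norm_le_zero_iff.1 h0)
    rw [hnorm] at h1
    have hξ0 : ‖ξ‖ ≠ 0 := (hξ.2 ▸ Real.rpow_pos_of_pos (norm_pos_iff.2 hx) _).ne'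
    exact (smul_right_injective _ (inv_ne_zero hξ0) h1).symm

theorem norm_dualitySel (hp : 1 < p) (x : E) : ‖dualitySel p x‖ = ‖x‖ ^ (p - 1) :=
  (dualitySel_mem hp x).2.symm

theorem IsUniformlySmooth.continuous_dualitySel (hE : IsUniformlySmooth E) (hp : 1 < p) :
    Continuous (dualitySel p : E → StrongDual ℝ E) := by
  have hnormcont : Continuous fun x : E => ‖x‖ ^ (p - 1) :=
    continuous_norm.rpow_const fun _ => Or.inr (sub_pos.2 hp).le
  refine continuous_iff_continuousAt.2 fun x => ?_
  rcases eq_or_ne x 0 with rfl | hx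
  · have h0 : dualitySel p (0 : E) = 0 := by
      rw [← norm_eq_zero, norm_dualitySel hp, norm_zero, Real.zero_rpow (sub_pos.2 hp).ne']
    rw [ContinuousAt, h0, tendsto_zero_iff_norm_tendsto_zero]
    simp only [norm_dualitySel hp]
    simpa [Real.zero_rpow (sub_pos.2 hp).ne'] using hnormcont.tendsto (0 : E)
  · -- the unit functionals converge, and the norms of the functionals converge
    have hz : ‖‖x‖⁻¹ • x‖ = 1 := norm_smul_inv_norm (𝕜 := ℝ) hx
    obtain ⟨f1, f2⟩ := norm_inv_smul_of_mem_dualityMap hx (dualitySel_mem hp x)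
    have hne : ∀ᶠ x' in 𝓝 x, x' ≠ 0 := isOpen_ne.mem_nhds hx
    have hunit : Tendsto (fun x' : E => ‖x'‖⁻¹ • x') (𝓝 x) (𝓝 (‖x‖⁻¹ • x)) :=
      (continuous_norm.continuousAt.inv₀ (norm_ne_zero_iff.2 hx)).smul continuousAt_id
    have hdir : Tendsto (fun x' : E => ‖dualitySel p x'‖⁻¹ • dualitySel p x') (𝓝 x)
        (𝓝 (‖dualitySel p x‖⁻¹ • dualitySel p x)) := by
      rw [Metric.tendsto_nhds]
      intro ε hε
      have hlim : Tendsto (fun τ : ℝ => 2 * (smoothnessModulus E τ / τ)) (𝓝[>] 0) (𝓝 0) := by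
        simpa using hE.const_mul 2
      obtain ⟨τ, hτ1, hτ⟩ := ((hlim.eventually (gt_mem_nhds (half_pos hε))).and
        self_mem_nhdsWithin).exists
      have hτ0 : 0 < τ := hτ
      have hclose := Metric.tendsto_nhds.1 hunit (τ * (ε / 2)) (by positivity)
      filter_upwards [hne, hclose] with x' hx' hd
      obtain ⟨g1, g2⟩ := norm_inv_smul_of_mem_dualityMap hx' (dualitySel_mem hp x')
      rw [dist_eq_norm]
      refine (norm_sub_le_of_norming hz f1 g1 f2 g2 hτ0).trans_lt ?_
      rw [dist_eq_norm, norm_sub_rev] at hd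
      have : ‖‖x‖⁻¹ • x - ‖x'‖⁻¹ • x'‖ / τ < ε / 2 := by
        rw [div_lt_iff₀ hτ0]; linarith
      linarith
    have hprod := (hnormcont.tendsto x).smul hdir
    simp only [← norm_dualitySel hp] at hprod
    have hpos : ∀ x' : E, x' ≠ 0 → ‖dualitySel p x'‖ ≠ 0 := fun x' hx' => by
      rw [norm_dualitySel hp]; exact (Real.rpow_pos_of_pos (norm_pos_iff.2 hx') _).ne'
    rw [smul_inv_smul₀ (hpos x hx)] at hprod
    refine hprod.congr' ?_
    filter_upwards [hne] with x' hx'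
    rw [smul_inv_smul₀ (hpos x' hx')]

end Smooth

/-! ### Duality in `p`-convex spaces -/

/-- Young's inequality with a weight on the first term. -/
theorem mul_le_mul_rpow_add_mul_rpow {p q : ℝ} (hpq : p.HolderConjugate q) {c s t : ℝ}
    (hc : 0 < c) (hs : 0 ≤ s) (ht : 0 ≤ t) : s * t ≤ c * t ^ p + c ^ (1 - q) * s ^ q := by
  have hp : 1 < p := hpq.lt
  rcases le_total s (c * t ^ (p - 1)) with h | h
  · have h1 : s * t ≤ c * t ^ p := by
      calc s * t ≤ c * t ^ (p - 1) * t := by gcongr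
        _ = c * t ^ p := by
          rw [mul_assoc, ← Real.rpow_add_one' ht (by linarith)]; congr 2; ring
    have : 0 ≤ c ^ (1 - q) * s ^ q := by positivity
    linarith
  · have h1 : t ≤ (s / c) ^ (q - 1) := by
      have h2 : t ^ (p - 1) ≤ s / c := by rw [le_div_iff₀ hc]; linarith
      have h3 := Real.rpow_le_rpow (Real.rpow_nonneg ht _) h2 hpq.symm.sub_one_pos.le
      rw [← Real.rpow_mul ht] at h3
      rwa [show (p - 1) * (q - 1) = 1 by linear_combination hpq.mul_eq_add, Real.rpow_one] at h3
    have h4 : s * (s / c) ^ (q - 1) = c ^ (1 - q) * s ^ q := by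
      rw [Real.div_rpow hs hc.le, show (1 - q) = -(q - 1) by ring, Real.rpow_neg hc.le]
      have : s ^ q = s ^ (q - 1) * s := by
        rw [← Real.rpow_add_one' hs (by linarith [hpq.symm.pos])]; congr 1; ring
      rw [this]; field_simp
    have : 0 ≤ c * t ^ p := by positivity
    have := mul_le_mul_of_nonneg_left h1 hs
    linarith

section PConvex

variable {E : Type*} [NormedAddCommGroup E] [NormedSpace ℝ E] {p q : ℝ}

/-- In a `p`-convex space the Bregman distance dominates the `p`-th power of the norm distance. -/
theorem IsPConvex.exists_le_fenchelGap (hpq : p.HolderConjugate q) (hp : 2 ≤ p)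
    (hE : IsPConvex E p) :
    ∃ c > 0, ∀ (x w : E) (ξ : StrongDual ℝ E), ξ ∈ dualityMap p x →
      c * ‖x - w‖ ^ p ≤ fenchelGap p q ξ w := by
  obtain ⟨c, hc, h⟩ := hE.exists_midpoint_rpow_le hp
  have hp0 : 0 < p := hpq.pos
  refine ⟨2 * c / p, by positivity, fun x w ξ hξ => ?_⟩
  have h0 := fenchelGap_eq_zero hpq hξ
  have h1 := fenchelGap_nonneg hpq ξ ((1 / 2 : ℝ) • (x + w))
  have h2 := div_le_div_of_nonneg_right (h x w) hp0.le
  unfold fenchelGap at *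
  rw [norm_smul, map_smul, map_add, smul_eq_mul,
    show ‖(1 / 2 : ℝ)‖ * ‖x + w‖ = ‖x + w‖ / 2 by rw [Real.norm_of_nonneg (by norm_num)]; ring] at h1
  have h3 : ((‖x‖ ^ p + ‖w‖ ^ p) / 2 - c * ‖x - w‖ ^ p) / p
      = (‖x‖ ^ p / p + ‖w‖ ^ p / p) / 2 - (2 * c / p * ‖x - w‖ ^ p) / 2 := by ring
  linarith

/-- A space element is determined by any of its dual elements. -/
theorem IsPConvex.eq_of_mem_dualityMap (hpq : p.HolderConjugate q) (hp : 2 ≤ p)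
    (hE : IsPConvex E p) {x w : E} {ξ : StrongDual ℝ E} (hx : ξ ∈ dualityMap p x)
    (hw : ξ ∈ dualityMap p w) : x = w := by
  obtain ⟨c, hc, h⟩ := hE.exists_le_fenchelGap hpq hp
  have h1 := h x w ξ hx
  rw [fenchelGap_eq_zero hpq hw] at h1
  have h2 : ‖x - w‖ ^ p = 0 :=
    le_antisymm (by nlinarith) (Real.rpow_nonneg (norm_nonneg _) _)
  exact sub_eq_zero.1 (norm_eq_zero.1 ((Real.rpow_eq_zero (norm_nonneg _) hpq.ne_zero).1 h2))

theorem bregmanConst_nonneg : 0 ≤ bregmanConst E q :=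
  Real.sInf_nonneg fun _ h => h.1.le

variable [CompleteSpace E]

/-- Every functional on a `p`-convex Banach space attains its norm: maximizing sequences in the
unit ball are Cauchy. -/
theorem IsPConvex.exists_apply_eq_norm (hp : 2 ≤ p) (hE : IsPConvex E p) (ξ : StrongDual ℝ E)
    (hξ : ξ ≠ 0) : ∃ z : E, ‖z‖ = 1 ∧ ξ z = ‖ξ‖ := by
  obtain ⟨c, hc, h⟩ := hE.exists_midpoint_rpow_le hp
  have hξ0 : 0 < ‖ξ‖ := norm_pos_iff.2 hξ
  have hp0 : 0 < p := by linarith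
  have hex : ∀ n : ℕ, ∃ z : E, ‖z‖ ≤ 1 ∧ ‖ξ‖ * (1 - 1 / ((n : ℝ) + 1)) ≤ ξ z := by
    intro n
    have hlt : ‖ξ‖ * (1 - 1 / ((n : ℝ) + 1)) < ‖ξ‖ := by
      have : 0 < ‖ξ‖ * (1 / ((n : ℝ) + 1)) := by positivity
      linarith
    obtain ⟨z, hz, hz'⟩ := ξ.exists_lt_apply_of_lt_opNorm hlt
    rcases abs_cases (ξ z) with ⟨h1, -⟩ | ⟨h1, -⟩
    · exact ⟨z, hz.le, by rw [Real.norm_eq_abs, h1] at hz'; exact hz'.le⟩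
    · refine ⟨-z, by rw [norm_neg]; exact hz.le, ?_⟩
      rw [Real.norm_eq_abs, h1] at hz'
      rw [map_neg]; exact hz'.le
  choose z hz1 hz2 using hex
  have hcau : CauchySeq z := by
    refine cauchySeq_of_le_tendsto_0 (fun n : ℕ => (p / c * (1 / ((n : ℝ) + 1))) ^ (1 / p)) ?_ ?_
    · intro n m k hn hm
      have hbound : ∀ j, k ≤ j → ‖ξ‖ * (1 - 1 / ((k : ℝ) + 1)) ≤ ξ (z j) := fun j hj => by
        refine le_trans ?_ (hz2 j)
        have : 1 / ((j : ℝ) + 1) ≤ 1 / ((k : ℝ) + 1) := by gcongr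
        gcongr
      have h1 : 1 - 1 / ((k : ℝ) + 1) ≤ ‖z n + z m‖ / 2 := by
        have h2 : ξ (z n + z m) ≤ ‖ξ‖ * ‖z n + z m‖ := (le_abs_self _).trans (ξ.le_opNorm _)
        rw [map_add] at h2
        have h3 : ‖ξ‖ * (1 - 1 / ((k : ℝ) + 1)) ≤ ‖ξ‖ * (‖z n + z m‖ / 2) := by
          linarith [hbound n hn, hbound m hm]
        exact le_of_mul_le_mul_left h3 hξ0
      have hk1 : 1 / ((k : ℝ) + 1) ≤ 1 := by
        rw [div_le_one (by positivity)]
        linarith [Nat.cast_nonneg (α := ℝ) k]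
      -- Bernoulli's inequality
      have h4 : 1 - p * (1 / ((k : ℝ) + 1)) ≤ (‖z n + z m‖ / 2) ^ p := by
        have := one_add_mul_self_le_rpow_one_add (s := -(1 / ((k : ℝ) + 1))) (p := p)
          (by linarith) (by linarith)
        calc 1 - p * (1 / ((k : ℝ) + 1)) = 1 + p * -(1 / ((k : ℝ) + 1)) := by ring
          _ ≤ _ := this
          _ ≤ _ := Real.rpow_le_rpow (by linarith) (by linarith) hp0.le
      have h5 := h (z n) (z m)
      have h6 : ∀ j, ‖z j‖ ^ p ≤ 1 := fun j => Real.rpow_le_one (norm_nonneg _) (hz1 j) hp0.le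
      have h7 : ‖z n - z m‖ ^ p ≤ p / c * (1 / ((k : ℝ) + 1)) := by
        rw [div_mul_eq_mul_div, le_div_iff₀ hc]
        linarith [h6 n, h6 m]
      rw [dist_eq_norm]
      calc ‖z n - z m‖ = (‖z n - z m‖ ^ p) ^ (1 / p) := by
            rw [← Real.rpow_mul (norm_nonneg _), mul_one_div_cancel hp0.ne', Real.rpow_one]
        _ ≤ _ := Real.rpow_le_rpow (by positivity) h7 (by positivity)
    · have h1 : Tendsto (fun n : ℕ => p / c * (1 / ((n : ℝ) + 1))) atTop (𝓝 0) := by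
        simpa using (tendsto_one_div_add_atTop_nhds_zero_nat (𝕜 := ℝ)).const_mul (p / c)
      have h2 := h1.rpow_const (p := 1 / p) (Or.inr (by positivity))
      rwa [Real.zero_rpow (by positivity)] at h2
  obtain ⟨z', hz'⟩ := cauchySeq_tendsto_of_complete hcau
  have hn : ‖z'‖ ≤ 1 := le_of_tendsto hz'.norm (Eventually.of_forall hz1)
  have hle : ‖ξ‖ ≤ ξ z' := by
    refine le_of_tendsto_of_tendsto ?_ ((ξ.continuous.tendsto z').comp hz')
      (Eventually.of_forall hz2)
    simpa using ((tendsto_one_div_add_atTop_nhds_zero_nat (𝕜 := ℝ)).const_sub 1).const_mul ‖ξ‖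
  have hle' : ξ z' ≤ ‖ξ‖ * ‖z'‖ := (le_abs_self _).trans (ξ.le_opNorm _)
  have hone : ‖z'‖ = 1 := le_antisymm hn (by nlinarith)
  exact ⟨z', hone, le_antisymm (by simpa [hone] using hle') hle⟩

theorem IsPConvex.exists_mem_dualityMap (hpq : p.HolderConjugate q) (hp : 2 ≤ p)
    (hE : IsPConvex E p) (ξ : StrongDual ℝ E) : ∃ x : E, ξ ∈ dualityMap p x := by
  rcases eq_or_ne ξ 0 with rfl | hξ
  · exact ⟨0, by simp [mem_dualityMap_iff, Real.zero_rpow hpq.sub_one_ne_zero]⟩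
  · obtain ⟨z, hz, hξz⟩ := hE.exists_apply_eq_norm hp ξ hξ
    have hn : ‖‖ξ‖ ^ (q - 1) • z‖ = ‖ξ‖ ^ (q - 1) := by
      rw [norm_smul, hz, mul_one, Real.norm_of_nonneg (by positivity)]
    refine ⟨‖ξ‖ ^ (q - 1) • z, ?_⟩
    rw [mem_dualityMap_iff, hn, map_smul, hξz, smul_eq_mul]
    refine ⟨rfl, ?_⟩
    rw [← Real.rpow_mul (norm_nonneg ξ),
      show (q - 1) * (p - 1) = 1 by linear_combination hpq.mul_eq_add, Real.rpow_one]

/-- `J_{p*}` on the dual space inverts `J_p`. -/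
theorem IsPConvex.mem_dualityMap_predualSel (hpq : p.HolderConjugate q) (hp : 2 ≤ p)
    (hE : IsPConvex E p) (ξ : StrongDual ℝ E) : ξ ∈ dualityMap p (predualSel q ξ) := by
  obtain ⟨x, hx⟩ := hE.exists_mem_dualityMap hpq hp ξ
  exact mem_dualityMap_of_inclusion_mem hpq
    (Classical.epsilon_spec (p := fun x : E =>
      NormedSpace.inclusionInDoubleDual ℝ E x ∈ dualityMap q ξ)
      ⟨x, inclusion_mem_dualityMap hpq hx⟩)

theorem IsPConvex.continuous_predualSel (hpq : p.HolderConjugate q) (hp : 2 ≤ p)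
    (hE : IsPConvex E p) : Continuous (predualSel q : StrongDual ℝ E → E) := by
  obtain ⟨c, hc, h⟩ := hE.exists_le_fenchelGap hpq hp
  refine continuous_iff_continuousAt.2 fun ξ => ?_
  rw [ContinuousAt, tendsto_iff_norm_sub_tendsto_zero]
  have hq1 : 0 < q - 1 := hpq.symm.sub_one_pos
  have hlim : Tendsto (fun η : StrongDual ℝ E => (‖η - ξ‖ / c) ^ (q - 1)) (𝓝 ξ) (𝓝 0) := by
    have h1 : Tendsto (fun η : StrongDual ℝ E => ‖η - ξ‖ / c) (𝓝 ξ) (𝓝 (0 / c)) :=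
      (tendsto_iff_norm_sub_tendsto_zero.1 tendsto_id).div_const c
    have h2 := h1.rpow_const (p := q - 1) (Or.inr hq1.le)
    rwa [zero_div, Real.zero_rpow hq1.ne'] at h2
  refine squeeze_zero (fun _ => norm_nonneg _) (fun η => ?_) hlim
  set x := predualSel q ξ
  set w := predualSel q η
  have hx : ξ ∈ dualityMap p x := hE.mem_dualityMap_predualSel hpq hp ξ
  have hw : η ∈ dualityMap p w := hE.mem_dualityMap_predualSel hpq hp η
  rcases eq_or_ne w x with heq | hne
  · rw [heq, sub_self, norm_zero]; positivity
  have hd : 0 < ‖w - x‖ := norm_pos_iff.2 (sub_ne_zero.2 hne)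
  have h1 := h w x η hw
  have h2 := fenchelGap_add_fenchelGap hpq hw hx
  have h3 := fenchelGap_nonneg hpq ξ w
  have h4 : (η - ξ) (w - x) ≤ ‖η - ξ‖ * ‖w - x‖ := (le_abs_self _).trans ((η - ξ).le_opNorm _)
  have h5 : ‖w - x‖ ^ p = ‖w - x‖ ^ (p - 1) * ‖w - x‖ := by
    rw [← Real.rpow_add_one hd.ne']; congr 1; ring
  have h6 : ‖w - x‖ ^ (p - 1) ≤ ‖η - ξ‖ / c := by
    rw [le_div_iff₀ hc]
    refine le_of_mul_le_mul_right ?_ hd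
    rw [h5] at h1
    linarith
  have h7 := Real.rpow_le_rpow (by positivity) h6 hq1.le
  rwa [← Real.rpow_mul (norm_nonneg _),
    show (p - 1) * (q - 1) = 1 by linear_combination hpq.mul_eq_add, Real.rpow_one] at h7

/-- The dual space of a `p`-convex space is `p*`-smooth. -/
theorem IsPConvex.exists_fenchelGap_le (hpq : p.HolderConjugate q) (hp : 2 ≤ p)
    (hE : IsPConvex E p) :
    ∃ G > 0, ∀ (x : E) (ξ η : StrongDual ℝ E), ξ ∈ dualityMap p x →
      fenchelGap p q η x ≤ G * ‖η - ξ‖ ^ q := by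
  obtain ⟨c, hc, h⟩ := hE.exists_le_fenchelGap hpq hp
  refine ⟨c ^ (1 - q), by positivity, fun x ξ η hx => ?_⟩
  obtain ⟨w, hw⟩ := hE.exists_mem_dualityMap hpq hp η
  have h1 := h x w ξ hx
  have h2 := fenchelGap_add_fenchelGap hpq hx hw
  have h3 : (ξ - η) (x - w) ≤ ‖η - ξ‖ * ‖x - w‖ := by
    rw [norm_sub_rev η]; exact (le_abs_self _).trans ((ξ - η).le_opNorm _)
  have h4 := mul_le_mul_rpow_add_mul_rpow hpq hc (norm_nonneg (η - ξ)) (norm_nonneg (x - w))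
  linarith

/-- A `p`-convex Banach space is reflexive. Given `F` in the bidual, an approximate minimizer
`ξ` of `η ↦ ‖η‖ ^ q / q - F η` is approximately critical, because the dual norm is smooth;
hence `F` is close to the element of the space which is dual to `ξ`. -/
theorem IsPConvex.surjective_inclusionInDoubleDual (hpq : p.HolderConjugate q) (hp : 2 ≤ p)
    (hE : IsPConvex E p) : Function.Surjective (NormedSpace.inclusionInDoubleDual ℝ E) := by
  obtain ⟨G, hG, h⟩ := hE.exists_fenchelGap_le hpq hp
  have hiso : Isometry (NormedSpace.inclusionInDoubleDual ℝ E) :=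
    (NormedSpace.inclusionInDoubleDualLi ℝ (E := E)).isometry
  have hclosed : IsClosed (Set.range (NormedSpace.inclusionInDoubleDual ℝ E)) :=
    hiso.isClosedEmbedding.isClosed_range
  intro F
  suffices hF : F ∈ closure (Set.range (NormedSpace.inclusionInDoubleDual ℝ E)) by
    rwa [hclosed.closure_eq] at hF
  refine (SeminormedAddCommGroup.mem_closure_iff (E := StrongDual ℝ (StrongDual ℝ E))).2 fun ε hε => ?_
  have hq1 : 0 < q - 1 := hpq.symm.sub_one_pos
  obtain ⟨t, ht0, ht⟩ : ∃ t : ℝ, 0 < t ∧ G * t ^ (q - 1) < ε / 4 := by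
    have h1 : Tendsto (fun t : ℝ => G * t ^ (q - 1)) (𝓝[>] 0) (𝓝 0) := by
      have h2 : Continuous fun t : ℝ => G * t ^ (q - 1) :=
        continuous_const.mul (Real.continuous_rpow_const hq1.le)
      have h3 := h2.tendsto 0
      rw [Real.zero_rpow hq1.ne', mul_zero] at h3
      exact h3.mono_left nhdsWithin_le_nhds
    obtain ⟨t, ht1, ht2⟩ := ((h1.eventually (gt_mem_nhds (by positivity : 0 < ε / 4))).and
      self_mem_nhdsWithin).exists
    exact ⟨t, ht2, ht1⟩
  set S := Set.range fun η : StrongDual ℝ E => fenchelGap q p F η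
  have hbdd : BddBelow S := ⟨0, by rintro _ ⟨η, rfl⟩; exact fenchelGap_nonneg hpq.symm F η⟩
  obtain ⟨-, ⟨ξ, rfl⟩, hξ⟩ := exists_lt_of_csInf_lt (Set.range_nonempty _)
    (lt_add_of_pos_right (sInf S) (by positivity : 0 < t * (ε / 4)))
  obtain ⟨x, hx⟩ := hE.exists_mem_dualityMap hpq hp ξ
  refine ⟨_, ⟨x, rfl⟩, ?_⟩
  have hgap : ∀ v : StrongDual ℝ E, F v - v x ≤ t * (ε / 4) + G * ‖v‖ ^ q := by
    intro v
    have h1 : sInf S ≤ fenchelGap q p F (ξ + v) := csInf_le hbdd ⟨_, rfl⟩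
    have h2 := h x ξ (ξ + v) hx
    have h3 := fenchelGap_eq_zero hpq hx
    simp only [fenchelGap, map_add, add_apply, add_sub_cancel_left] at h1 h2 h3 hξ
    linarith
  refine lt_of_le_of_lt (b := ε / 2) ?_ (by linarith)
  have key : ∀ v : StrongDual ℝ E, ‖v‖ = 1 →
      (F - NormedSpace.inclusionInDoubleDual ℝ E x) v ≤ ε / 2 := by
    intro v hv
    have h1 := hgap (t • v)
    have h2 : t ^ q = t * t ^ (q - 1) := by
      rw [mul_comm, ← Real.rpow_add_one ht0.ne']; congr 1; ring
    rw [norm_smul, hv, mul_one, Real.norm_of_nonneg ht0.le, h2, map_smul, smul_apply,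
      smul_eq_mul, smul_eq_mul] at h1
    have h3 : t * (F v - v x) ≤ t * (ε / 4 + G * t ^ (q - 1)) := by linarith
    have h4 := le_of_mul_le_mul_left h3 ht0
    rw [sub_apply, NormedSpace.dual_def]
    linarith
  refine ContinuousLinearMap.opNorm_le_of_unit_norm (by positivity) fun v hv => ?_
  refine abs_le.2 ⟨?_, key v hv⟩
  have := key (-v) (by rw [norm_neg, hv])
  rw [map_neg] at this
  linarith

theorem IsPConvex.dualitySel_eq_inclusion (hpq : p.HolderConjugate q) (hp : 2 ≤ p)
    (hE : IsPConvex E p) {x : E} {ξ : StrongDual ℝ E} (h : ξ ∈ dualityMap p x) :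
    dualitySel q ξ = NormedSpace.inclusionInDoubleDual ℝ E x := by
  obtain ⟨w, hw⟩ := hE.surjective_inclusionInDoubleDual hpq hp (dualitySel q ξ)
  have hmem := dualitySel_mem hpq.symm.lt ξ
  rw [← hw] at hmem ⊢
  rw [hE.eq_of_mem_dualityMap hpq hp (mem_dualityMap_of_inclusion_mem hpq hmem) h]

theorem IsPConvex.bregman_dual_eq (hpq : p.HolderConjugate q) (hp : 2 ≤ p)
    (hE : IsPConvex E p) {x : E} {ξ : StrongDual ℝ E} (h : ξ ∈ dualityMap p x)
    (η : StrongDual ℝ E) : bregman q ξ η = fenchelGap p q η x := by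
  rw [bregman, fenchelGap, hpq.symm.conjExponent_eq, norm_rpow_of_mem_dualityMap hpq h,
    hE.dualitySel_eq_inclusion hpq hp h, NormedSpace.dual_def]
  ring

/-- The infimum defining `bregmanConst` is over a non-empty set and is attained. -/
theorem IsPConvex.fenchelGap_le_bregmanConst (hpq : p.HolderConjugate q) (hp : 2 ≤ p)
    (hE : IsPConvex E p) {x : E} {ξ : StrongDual ℝ E} (h : ξ ∈ dualityMap p x)
    (η : StrongDual ℝ E) :
    fenchelGap p q η x ≤ bregmanConst (StrongDual ℝ E) q / q * ‖η - ξ‖ ^ q := by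
  have hq0 : 0 < q := hpq.symm.pos
  rw [← hE.bregman_dual_eq hpq hp h]
  set S := {G : ℝ | 0 < G ∧ ∀ z w : StrongDual ℝ E, bregman q z w ≤ G / q * ‖w - z‖ ^ q} with hS
  have hne : S.Nonempty := by
    obtain ⟨G, hG, hle⟩ := hE.exists_fenchelGap_le hpq hp
    refine ⟨q * G, by positivity, fun z w => ?_⟩
    obtain ⟨x, hx⟩ := hE.exists_mem_dualityMap hpq hp z
    rw [hE.bregman_dual_eq hpq hp hx, mul_div_cancel_left₀ _ hq0.ne']
    exact hle x z w hx
  rcases eq_or_lt_of_le (Real.rpow_nonneg (norm_nonneg (η - ξ)) q) with h0 | hpos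
  · obtain ⟨G, hG⟩ := hne
    have := hG.2 ξ η
    rwa [← h0, mul_zero] at this ⊢
  · have h1 : bregman q ξ η * q / ‖η - ξ‖ ^ q ≤ sInf S := by
      refine le_csInf hne fun G hG => ?_
      rw [div_le_iff₀ hpos]
      have := mul_le_mul_of_nonneg_right (hG.2 ξ η) hq0.le
      have h2 : G / q * ‖η - ξ‖ ^ q * q = G * ‖η - ξ‖ ^ q := by field_simp
      linarith
    rw [div_le_iff₀ hpos] at h1
    change _ ≤ sInf S / q * _
    rw [div_mul_eq_mul_div, le_div_iff₀ hq0]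
    exact h1

end PConvex

/-! ### Minimum norm solutions -/

section MinNorm

variable {X Z : Type*} [NormedAddCommGroup X] [NormedSpace ℝ X]
  [NormedAddCommGroup Z] [NormedSpace ℝ Z] {p q : ℝ}

/-- The range of the adjoint operator, as a subspace of the dual space. -/
def adjointRangeSubmodule (A : X →L[ℝ] Z) : Submodule ℝ (StrongDual ℝ X) :=
  LinearMap.range ((ContinuousLinearMap.compL ℝ X Z ℝ).flip A).toLinearMap

theorem coe_adjointRangeSubmodule (A : X →L[ℝ] Z) :
    (adjointRangeSubmodule A : Set (StrongDual ℝ X)) = adjointRange A := rfl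

/-- Over a reflexive space, the annihilator of the kernel lies in the norm closure of the range of
the adjoint operator. -/
theorem mem_closure_adjointRange
    (hX : Function.Surjective (NormedSpace.inclusionInDoubleDual ℝ X)) (A : X →L[ℝ] Z)
    {ζ : StrongDual ℝ X} (hζ : ∀ h : X, A h = 0 → ζ h = 0) : ζ ∈ closure (adjointRange A) := by
  by_contra hcon
  have hconv : Convex ℝ (closure (adjointRange A)) := by
    rw [← coe_adjointRangeSubmodule]
    exact (adjointRangeSubmodule A).convex.closure
  obtain ⟨F, u, hu, hF⟩ := geometric_hahn_banach_point_closed hconv isClosed_closure hcon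
  obtain ⟨x, rfl⟩ := hX F
  simp only [NormedSpace.dual_def] at hu hF
  have hlin : ∀ φ : StrongDual ℝ Z, u < φ (A x) := fun φ => hF _ (subset_closure ⟨φ, rfl⟩)
  have hu0 : u < 0 := by simpa using hlin 0
  have hzero : A x = 0 := by
    by_contra hne
    obtain ⟨g, hg⟩ := SeparatingDual.exists_ne_zero (R := ℝ) hne
    have := hlin ((u / g (A x)) • g)
    rw [smul_apply, smul_eq_mul, div_mul_cancel₀ _ hg] at this
    exact lt_irrefl _ this
  rw [hζ x hzero] at hu
  linarith

/-- The dual element of a minimum norm solution annihilates the kernel: it is the norming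
functional which factors through the quotient by the kernel. -/
theorem IsMinNormSolution.dualitySel_apply_eq_zero (hp : 1 < p) (hX : IsUniformlySmooth X)
    {A : X →L[ℝ] Z} {y : Z} {x : X} (hx : IsMinNormSolution A y x) {h : X} (hh : A h = 0) :
    dualitySel p x h = 0 := by
  rcases eq_or_ne x 0 with rfl | hx0
  · have h0 : dualitySel p (0 : X) = 0 := by
      rw [← norm_eq_zero, norm_dualitySel hp, norm_zero, Real.zero_rpow (sub_pos.2 hp).ne']
    rw [h0, zero_apply]
  have hmin : ∀ k : X, A k = 0 → ‖x‖ ≤ ‖x - k‖ := fun k hk => by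
    rw [hx.2]
    refine csInf_le ⟨0, ?_⟩ ⟨x - k, by rw [map_sub, hk, sub_zero, hx.1], rfl⟩
    rintro _ ⟨_, -, rfl⟩
    exact norm_nonneg _
  set S : Submodule ℝ X := LinearMap.ker A.toLinearMap with hS
  have hle : ‖x‖ ≤ ‖(Submodule.Quotient.mk x : X ⧸ S)‖ := by
    change ‖x‖ ≤ ‖((x : X) : X ⧸ S.toAddSubgroup)‖
    rw [QuotientAddGroup.norm_mk]
    refine (Metric.le_infDist ⟨0, S.zero_mem⟩).2 fun {k} hk => ?_
    rw [dist_eq_norm]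
    exact hmin k (LinearMap.mem_ker.1 hk)
  have hnorm : ‖(Submodule.Quotient.mk x : X ⧸ S)‖ = ‖x‖ :=
    le_antisymm (Submodule.Quotient.norm_mk_le S x) hle
  have hxn : ‖x‖ ≠ 0 := norm_ne_zero_iff.2 hx0
  obtain ⟨g, hg1, hg2⟩ := exists_dual_vector ℝ (Submodule.Quotient.mk x : X ⧸ S) (hnorm ▸ hxn)
  have hbound : ∀ v : X, ‖(g.toLinearMap.comp S.mkQ) v‖ ≤ 1 * ‖v‖ := fun v => by
    calc ‖g (Submodule.Quotient.mk v)‖ ≤ ‖g‖ * ‖(Submodule.Quotient.mk v : X ⧸ S)‖ :=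
          g.le_opNorm _
      _ ≤ _ := by rw [hg1]; gcongr; exact Submodule.Quotient.norm_mk_le S v
  set f : StrongDual ℝ X := (g.toLinearMap.comp S.mkQ).mkContinuous 1 hbound with hf
  have hfx : f x = ‖x‖ := by
    change g (Submodule.Quotient.mk x) = ‖x‖
    rw [hg2, hnorm]; rfl
  have hfn : ‖f‖ = 1 := by
    refine le_antisymm (LinearMap.mkContinuous_norm_le _ zero_le_one _) ?_
    have h1 := f.le_opNorm x
    rw [hfx, norm_norm] at h1
    exact le_of_mul_le_mul_right (by simpa using h1) ((norm_nonneg x).lt_of_ne' hxn)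
  have hfh : f h = 0 := by
    change g (Submodule.Quotient.mk h) = 0
    rw [(Submodule.Quotient.mk_eq_zero S).2 (LinearMap.mem_ker.2 hh), map_zero]
  have hmem : ‖x‖ ^ (p - 1) • f ∈ dualityMap p x := by
    have hn : ‖‖x‖ ^ (p - 1) • f‖ = ‖x‖ ^ (p - 1) := by
      rw [norm_smul, hfn, mul_one, Real.norm_of_nonneg (by positivity)]
    refine ⟨?_, hn.symm⟩
    rw [hn, smul_apply, hfx, smul_eq_mul, mul_comm]
  rw [hX.eq_of_mem_dualityMap hp (dualitySel_mem hp x) hmem, smul_apply, hfh, smul_zero]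

end MinNorm

/-! ### Pathwise estimates for the iterates -/

section Pathwise

variable {X : Type*} [NormedAddCommGroup X] [NormedSpace ℝ X]
  {N : ℕ} {Y : Fin N → Type*} [∀ i, NormedAddCommGroup (Y i)] [∀ i, NormedSpace ℝ (Y i)]
  {r : ℝ≥0∞} {p q : ℝ}

theorem component_apply (A : X →L[ℝ] PiLp r Y) (i : Fin N) (x : X) :
    component A i x = A x i := rfl

theorem direction_apply (A : X →L[ℝ] PiLp r Y) (x : X) (y : PiLp r Y) (i : Fin N) (v : X) :
    direction p A x y i v = dualitySel p (component A i x - y i) (component A i v) := rfl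

theorem Lmax_nonneg (A : X →L[ℝ] PiLp r Y) : 0 ≤ Lmax A :=
  Real.iSup_nonneg fun _ => norm_nonneg _

theorem norm_component_le_Lmax (A : X →L[ℝ] PiLp r Y) (i : Fin N) : ‖component A i‖ ≤ Lmax A :=
  le_ciSup (f := fun i => ‖component A i‖) (Set.finite_range _).bddAbove i

theorem norm_direction_le (hp : 1 < p) (A : X →L[ℝ] PiLp r Y) (x : X) (y : PiLp r Y)
    (i : Fin N) : ‖direction p A x y i‖ ≤ Lmax A * ‖component A i x - y i‖ ^ (p - 1) := by
  calc ‖direction p A x y i‖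
      ≤ ‖dualitySel p (component A i x - y i)‖ * ‖component A i‖ :=
        ContinuousLinearMap.opNorm_comp_le _ _
    _ ≤ ‖component A i x - y i‖ ^ (p - 1) * Lmax A := by
        rw [norm_dualitySel hp]; gcongr; exact norm_component_le_Lmax A i
    _ = _ := mul_comm _ _

/-- The sum of the norms of the components of the residual `A x - y`. -/
def residual (A : X →L[ℝ] PiLp r Y) (y : PiLp r Y) (x : X) : ℝ :=
  ∑ i, ‖component A i x - y i‖

theorem norm_component_le_residual (A : X →L[ℝ] PiLp r Y) (y : PiLp r Y) (x : X) (i : Fin N) :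
    ‖component A i x - y i‖ ≤ residual A y x :=
  Finset.single_le_sum (f := fun i => ‖component A i x - y i‖) (fun _ _ => norm_nonneg _)
    (Finset.mem_univ i)

theorem residual_nonneg (A : X →L[ℝ] PiLp r Y) (y : PiLp r Y) (x : X) : 0 ≤ residual A y x :=
  Finset.sum_nonneg fun _ _ => norm_nonneg _

theorem residual_rpow_le (hp : 1 ≤ p) (A : X →L[ℝ] PiLp r Y) (y : PiLp r Y) (x : X) :
    residual A y x ^ p ≤ (N : ℝ) ^ (p - 1) * ∑ j, ‖component A j x - y j‖ ^ p := by
  simpa [residual] using Real.rpow_sum_le_const_mul_sum_rpow_of_nonneg Finset.univ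
    (f := fun j => ‖component A j x - y j‖) hp fun _ _ => norm_nonneg _

theorem norm_sub_le_residual [Fact (1 ≤ r)] (A : X →L[ℝ] PiLp r Y) (y : PiLp r Y) (x : X) :
    ‖A x - y‖ ≤ residual A y x := by
  have h : A x - y = ∑ i, PiLp.single r i ((A x - y) i) := by
    ext j
    rw [WithLp.ofLp_sum, Finset.sum_apply, Finset.sum_eq_single j]
    · simp
    · intro i _ hij
      simp [Pi.single_eq_of_ne hij.symm]
    · simp
  rw [h]
  refine (norm_sum_le _ _).trans (Finset.sum_le_sum fun i _ => ?_)
  rw [PiLp.norm_single]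
  exact le_rfl

theorem bregman_nonneg (hpq : p.HolderConjugate q) (z w : X) : 0 ≤ bregman p z w := by
  rw [bregman_eq_fenchelGap hpq]
  exact fenchelGap_nonneg hpq _ _

theorem continuous_bregman_left (hp : 1 < p) (hsm : IsUniformlySmooth X) (w : X) :
    Continuous fun z : X => bregman p z w := by
  unfold bregman
  refine Continuous.sub (Continuous.add ?_ continuous_const) ?_
  · exact (continuous_norm.rpow_const fun _ => Or.inr (by linarith)).div_const _
  · exact (hsm.continuous_dualitySel hp).clm_apply continuous_const

theorem iterate_congr (A : X →L[ℝ] PiLp r Y) (y : PiLp r Y) (μ : ℕ → ℝ) (x₀ : X)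
    {s s' : ℕ → Fin N} {n : ℕ} (h : ∀ l ∈ Set.Icc 1 n, s l = s' l) :
    iterate p q A y μ x₀ s n = iterate p q A y μ x₀ s' n := by
  induction n with
  | zero => rfl
  | succ n ih =>
    simp only [iterate]
    rw [ih fun l hl => h l ⟨hl.1, hl.2.trans n.le_succ⟩, h (n + 1) ⟨Nat.le_add_left 1 n, le_rfl⟩]

theorem sum_range_succ_eq_sum_Icc (μ : ℕ → ℝ) (n : ℕ) :
    ∑ k ∈ Finset.range n, μ (k + 1) = ∑ l ∈ Finset.Icc 1 n, μ l := by
  induction n with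
  | zero => simp
  | succ n ih => rw [Finset.sum_range_succ, Finset.sum_Icc_succ_top (Nat.le_add_left 1 n), ih]

/-- The total variation of the dual iterates is bounded by a power of the sum of the step sizes,
by Hölder's inequality and the summability of the residuals along the path. -/
theorem sum_mul_rpow_le (hpq : p.HolderConjugate q) {μ a : ℕ → ℝ} (hμ : ∀ k, 1 ≤ k → 0 < μ k)
    (ha : ∀ k, 0 ≤ a k) {M : ℝ} (n : ℕ)
    (hM : ∑ k ∈ Finset.range n, μ (k + 1) * a k ^ p ≤ M) :
    ∑ k ∈ Finset.range n, μ (k + 1) * a k ^ (p - 1)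
      ≤ (∑ l ∈ Finset.Icc 1 n, μ l) ^ (1 / p) * M ^ (1 / q) := by
  have hpos : ∀ k, 0 < μ (k + 1) := fun k => hμ _ (Nat.le_add_left 1 k)
  have hsplit : ∀ k, μ (k + 1) * a k ^ (p - 1)
      = μ (k + 1) ^ (1 / p) * (μ (k + 1) ^ (1 / q) * a k ^ (p - 1)) := fun k => by
    rw [← mul_assoc, ← Real.rpow_add (hpos k), one_div, one_div, hpq.inv_add_inv_eq_one,
      Real.rpow_one]
  have h1 : ∀ k, (μ (k + 1) ^ (1 / p)) ^ p = μ (k + 1) := fun k => by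
    rw [← Real.rpow_mul (hpos k).le, one_div_mul_cancel hpq.ne_zero, Real.rpow_one]
  have h2 : ∀ k, (μ (k + 1) ^ (1 / q) * a k ^ (p - 1)) ^ q = μ (k + 1) * a k ^ p := fun k => by
    rw [Real.mul_rpow (by have := hpos k; positivity) (Real.rpow_nonneg (ha k) _),
      ← Real.rpow_mul (hpos k).le, one_div_mul_cancel hpq.symm.ne_zero, Real.rpow_one,
      ← Real.rpow_mul (ha k), hpq.sub_one_mul_conj]
  have h3 := Real.inner_le_Lp_mul_Lq_of_nonneg (Finset.range n)
    (f := fun k => μ (k + 1) ^ (1 / p)) (g := fun k => μ (k + 1) ^ (1 / q) * a k ^ (p - 1)) hpq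
    (fun k _ => Real.rpow_nonneg (hpos k).le _)
    (fun k _ => mul_nonneg (Real.rpow_nonneg (hpos k).le _) (Real.rpow_nonneg (ha k) _))
  simp only [h1, h2, ← hsplit] at h3
  rw [sum_range_succ_eq_sum_Icc] at h3
  refine h3.trans ?_
  have h4 : 0 ≤ ∑ k ∈ Finset.range n, μ (k + 1) * a k ^ p :=
    Finset.sum_nonneg fun k _ => mul_nonneg (hpos k).le (Real.rpow_nonneg (ha k) _)
  have h5 : 0 ≤ ∑ l ∈ Finset.Icc 1 n, μ l :=
    Finset.sum_nonneg fun l hl => (hμ l (Finset.mem_Icc.1 hl).1).le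
  have h6 : 0 ≤ 1 / q := by have := hpq.symm.pos; positivity
  gcongr

variable [CompleteSpace X]

theorem dualitySel_predualSel (hpq : p.HolderConjugate q) (hp : 2 ≤ p) (hconv : IsPConvex X p)
    (hsm : IsUniformlySmooth X) (ξ : StrongDual ℝ X) : dualitySel p (predualSel q ξ) = ξ :=
  hsm.eq_of_mem_dualityMap hpq.lt (dualitySel_mem hpq.lt _)
    (hconv.mem_dualityMap_predualSel hpq hp ξ)

theorem dualitySel_iterate (hpq : p.HolderConjugate q) (hp : 2 ≤ p)
    (hconv : IsPConvex X p) (hsm : IsUniformlySmooth X) (A : X →L[ℝ] PiLp r Y) (y : PiLp r Y)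
    (μ : ℕ → ℝ) (x₀ : X) (s : ℕ → Fin N) (n : ℕ) :
    dualitySel p (iterate p q A y μ x₀ s n) = dualitySel p x₀ - ∑ k ∈ Finset.range n,
      μ (k + 1) • direction p A (iterate p q A y μ x₀ s k) y (s (k + 1)) := by
  induction n with
  | zero => simp [iterate]
  | succ n ih =>
    rw [Finset.sum_range_succ, ← sub_sub, ← ih]
    exact dualitySel_predualSel hpq hp hconv hsm _

/-- Along a fixed path of indices the iterates depend continuously on the data. -/
theorem continuous_iterate (hpq : p.HolderConjugate q) (hp : 2 ≤ p) (hconv : IsPConvex X p)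
    (hsm : IsUniformlySmooth X) (hY : ∀ i, IsUniformlySmooth (Y i)) (A : X →L[ℝ] PiLp r Y)
    (μ : ℕ → ℝ) (x₀ : X) (s : ℕ → Fin N) (n : ℕ) :
    Continuous fun y : PiLp r Y => iterate p q A y μ x₀ s n := by
  induction n with
  | zero => exact continuous_const
  | succ n ih =>
    have hdir : Continuous fun y : PiLp r Y =>
        direction p A (iterate p q A y μ x₀ s n) y (s (n + 1)) := by
      refine Continuous.clm_comp (((hY (s (n + 1))).continuous_dualitySel hpq.lt).comp ?_)
        continuous_const
      exact ((component A (s (n + 1))).continuous.comp ih).sub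
        (PiLp.proj (𝕜 := ℝ) r Y (s (n + 1))).continuous
    exact (hconv.continuous_predualSel hpq hp).comp
      (((hsm.continuous_dualitySel hpq.lt).comp ih).sub (hdir.const_smul (μ (n + 1))))

/-- The change of the Bregman distance to an exact solution `w` in one step, for data `y'` whose
`i`-th component is off by at most `δ`. -/
theorem bregman_step_le (hpq : p.HolderConjugate q) (hp : 2 ≤ p) (hconv : IsPConvex X p)
    (hsm : IsUniformlySmooth X) (A : X →L[ℝ] PiLp r Y) {y y' : PiLp r Y} {w : X} (hw : A w = y)
    {C δ m : ℝ} (hm : 0 < m)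
    (hC : C < 1 - Lmax A ^ q * (bregmanConst (StrongDual ℝ X) q / q) * m ^ (q - 1))
    (x : X) (i : Fin N) (hδ : ‖y' i - y i‖ ≤ δ) :
    bregman p (predualSel q (dualitySel p x - m • direction p A x y' i)) w
        + C * (m * ‖component A i x - y' i‖ ^ p)
      ≤ bregman p x w + m * (δ * ‖component A i x - y' i‖ ^ (p - 1)) := by
  set ξ := dualitySel p x with hξ
  have hx : ξ ∈ dualityMap p x := dualitySel_mem hpq.lt x
  set η := ξ - m • direction p A x y' i with hη
  set ρ := component A i x - y' i with hρ
  set κ := bregmanConst (StrongDual ℝ X) q / q with hκ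
  have hκ0 : 0 ≤ κ := div_nonneg bregmanConst_nonneg hpq.symm.nonneg
  rw [bregman_eq_fenchelGap hpq, bregman_eq_fenchelGap hpq,
    dualitySel_predualSel hpq hp hconv hsm, fenchelGap_eq_add hpq hx η w]
  have hηξ : η - ξ = -(m • direction p A x y' i) := by rw [hη]; abel
  have h1 : fenchelGap p q η x ≤ Lmax A ^ q * κ * m ^ (q - 1) * (m * ‖ρ‖ ^ p) := by
    have h2 := hconv.fenchelGap_le_bregmanConst hpq hp hx η
    have h3 : ‖η - ξ‖ ≤ m * (Lmax A * ‖ρ‖ ^ (p - 1)) := by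
      rw [hηξ, norm_neg, norm_smul, Real.norm_of_nonneg hm.le]
      gcongr
      exact norm_direction_le hpq.lt A x y' i
    have h4 : ‖η - ξ‖ ^ q ≤ (m * (Lmax A * ‖ρ‖ ^ (p - 1))) ^ q :=
      Real.rpow_le_rpow (norm_nonneg _) h3 hpq.symm.nonneg
    have h5 : (m * (Lmax A * ‖ρ‖ ^ (p - 1))) ^ q
        = m ^ (q - 1) * m * (Lmax A ^ q * ‖ρ‖ ^ p) := by
      rw [Real.mul_rpow hm.le (mul_nonneg (Lmax_nonneg A) (by positivity)),
        Real.mul_rpow (Lmax_nonneg A) (by positivity), ← Real.rpow_mul (norm_nonneg ρ),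
        hpq.sub_one_mul_conj, ← Real.rpow_add_one hm.ne']
      congr 2; ring
    calc fenchelGap p q η x ≤ κ * ‖η - ξ‖ ^ q := h2
      _ ≤ κ * (m ^ (q - 1) * m * (Lmax A ^ q * ‖ρ‖ ^ p)) := by rw [← h5]; gcongr
      _ = _ := by ring
  have h6 : (η - ξ) (w - x) = m * dualitySel p ρ (ρ + (y' i - y i)) := by
    have h7 : component A i (w - x) = -(ρ + (y' i - y i)) := by
      rw [map_sub, component_apply A i w, hw, hρ]; abel
    rw [hηξ, neg_apply, smul_apply, direction_apply, h7, map_neg, smul_eq_mul]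
    ring
  have h8 : ‖ρ‖ ^ p - δ * ‖ρ‖ ^ (p - 1) ≤ dualitySel p ρ (ρ + (y' i - y i)) := by
    rw [map_add, apply_self_of_mem_dualityMap hpq (dualitySel_mem hpq.lt ρ)]
    have h9 := (abs_le.1 ((dualitySel p ρ).le_opNorm (y' i - y i))).1
    rw [norm_dualitySel hpq.lt] at h9
    have h10 : ‖ρ‖ ^ (p - 1) * ‖y' i - y i‖ ≤ ‖ρ‖ ^ (p - 1) * δ := by gcongr
    linarith
  have h11 := mul_le_mul_of_nonneg_left h8 hm.le
  have h12 := mul_le_mul_of_nonneg_right hC.le (by positivity : 0 ≤ m * ‖ρ‖ ^ p)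
  rw [h6]
  linarith

/-- With exact data the Bregman distance to a solution decreases, and the decrease controls the
residuals of the sampled components. -/
theorem bregman_iterate_add_le (hpq : p.HolderConjugate q) (hp : 2 ≤ p)
    (hconv : IsPConvex X p) (hsm : IsUniformlySmooth X) (A : X →L[ℝ] PiLp r Y) {y : PiLp r Y}
    {w : X} (hw : A w = y) {C : ℝ} {μ : ℕ → ℝ} (hμ : ∀ k, 1 ≤ k → 0 < μ k)
    (hC : ∀ k, 1 ≤ k →
      C < 1 - Lmax A ^ q * (bregmanConst (StrongDual ℝ X) q / q) * μ k ^ (q - 1))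
    (x₀ : X) (s : ℕ → Fin N) (n : ℕ) :
    bregman p (iterate p q A y μ x₀ s n) w + C * ∑ k ∈ Finset.range n, μ (k + 1) *
      ‖component A (s (k + 1)) (iterate p q A y μ x₀ s k) - y (s (k + 1))‖ ^ p
      ≤ bregman p x₀ w := by
  induction n with
  | zero => simp [iterate]
  | succ n ih =>
    have hstep := bregman_step_le hpq hp hconv hsm A hw (hμ (n + 1) (Nat.le_add_left 1 n))
      (hC (n + 1) (Nat.le_add_left 1 n)) (iterate p q A y μ x₀ s n)
      (s (n + 1)) (y' := y) (δ := 0) (by rw [sub_self, norm_zero])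
    rw [Finset.sum_range_succ, mul_add]
    change bregman p (predualSel q _) w + _ ≤ _
    simp only [zero_mul, mul_zero, add_zero] at hstep
    linarith

variable [Fact (1 ≤ r)]

/-- With noisy data the Bregman distance to an exact solution grows by at most a multiple of
`δ ^ p` times the sum of the step sizes. -/
theorem bregman_iterate_le_of_noise (hpq : p.HolderConjugate q) (hp : 2 ≤ p)
    (hconv : IsPConvex X p) (hsm : IsUniformlySmooth X) (A : X →L[ℝ] PiLp r Y) {y y' : PiLp r Y}
    {w : X} (hw : A w = y) {C δ : ℝ} (hC0 : 0 < C) (hδ0 : 0 ≤ δ) (hδ : ‖y' - y‖ ≤ δ)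
    {μ : ℕ → ℝ} (hμ : ∀ k, 1 ≤ k → 0 < μ k)
    (hC : ∀ k, 1 ≤ k →
      C < 1 - Lmax A ^ q * (bregmanConst (StrongDual ℝ X) q / q) * μ k ^ (q - 1))
    (x₀ : X) (s : ℕ → Fin N) {m n : ℕ} (hmn : m ≤ n) :
    bregman p (iterate p q A y' μ x₀ s n) w ≤ bregman p (iterate p q A y' μ x₀ s m) w
      + C ^ (1 - p) * (δ ^ p * ∑ l ∈ Finset.Icc 1 n, μ l) := by
  have hc : 0 ≤ C ^ (1 - p) * δ ^ p := by positivity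
  suffices h : bregman p (iterate p q A y' μ x₀ s n) w
      + C ^ (1 - p) * (δ ^ p * ∑ l ∈ Finset.Icc 1 m, μ l)
      ≤ bregman p (iterate p q A y' μ x₀ s m) w
      + C ^ (1 - p) * (δ ^ p * ∑ l ∈ Finset.Icc 1 n, μ l) by
    have h0 : 0 ≤ ∑ l ∈ Finset.Icc 1 m, μ l :=
      Finset.sum_nonneg fun l hl => (hμ l (Finset.mem_Icc.1 hl).1).le
    have : 0 ≤ C ^ (1 - p) * (δ ^ p * ∑ l ∈ Finset.Icc 1 m, μ l) := by positivity
    linarith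
  induction n, hmn using Nat.le_induction with
  | base => exact le_rfl
  | succ n _ ih =>
    have hpos := hμ (n + 1) (Nat.le_add_left 1 n)
    set x := iterate p q A y' μ x₀ s n with hx
    have hstep := bregman_step_le hpq hp hconv hsm A hw hpos (hC (n + 1) (Nat.le_add_left 1 n)) x
      (s (n + 1)) (δ := δ) ((PiLp.norm_apply_le (y' - y) (s (n + 1))).trans hδ)
    set ρ := component A (s (n + 1)) x - y' (s (n + 1))
    have hyoung := mul_le_mul_rpow_add_mul_rpow hpq.symm hC0 hδ0
      (by positivity : 0 ≤ ‖ρ‖ ^ (p - 1))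
    rw [← Real.rpow_mul (norm_nonneg ρ), hpq.sub_one_mul_conj] at hyoung
    have h1 := mul_le_mul_of_nonneg_left hyoung hpos.le
    rw [Finset.sum_Icc_succ_top (Nat.le_add_left 1 n)]
    change bregman p (predualSel q _) w + _ ≤ _
    linarith

/-- For exact data, the Bregman distance to the minimum norm solution is controlled by the
current residual, with a constant growing like the sum of the step sizes to the power `1 / p`.
Up to an element of the range of `A*`, the dual iterate `J_p(x_n) - J_p(x†)` is the sum of the
update directions plus an error as small as we please. -/
theorem exists_bregman_iterate_le (hpq : p.HolderConjugate q) (hp : 2 ≤ p)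
    (hconv : IsPConvex X p) (hsm : IsUniformlySmooth X) (A : X →L[ℝ] PiLp r Y) {y : PiLp r Y}
    {xdag : X} (hxdag : IsMinNormSolution A y xdag) {x₀ : X}
    (hx₀ : dualitySel p x₀ ∈ closure (adjointRange A)) {C : ℝ} (hC0 : 0 < C) {μ : ℕ → ℝ}
    (hμ : ∀ k, 1 ≤ k → 0 < μ k)
    (hC : ∀ k, 1 ≤ k →
      C < 1 - Lmax A ^ q * (bregmanConst (StrongDual ℝ X) q / q) * μ k ^ (q - 1))
    {ε : ℝ} (hε : 0 < ε) :
    ∃ B, 0 ≤ B ∧ ∀ (s : ℕ → Fin N) (n : ℕ), bregman p (iterate p q A y μ x₀ s n) xdag ≤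
      B * ((1 + (∑ l ∈ Finset.Icc 1 n, μ l) ^ (1 / p))
        * residual A y (iterate p q A y μ x₀ s n)) + ε := by
  obtain ⟨c, hc, hlow⟩ := hconv.exists_le_fenchelGap hpq hp
  set D₀ := bregman p x₀ xdag with hD₀
  have hD₀0 : 0 ≤ D₀ := bregman_nonneg hpq _ _
  -- The iterates stay in a ball around the solution.
  set M := (D₀ / c) ^ (1 / p) with hMdef
  have hM0 : 0 ≤ M := by positivity
  have hsolve : A xdag = y := hxdag.1
  have hbound := bregman_iterate_add_le hpq hp hconv hsm A hsolve hμ hC x₀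
  have hsumnn : ∀ (s : ℕ → Fin N) (n : ℕ), 0 ≤ ∑ k ∈ Finset.range n, μ (k + 1) *
      ‖component A (s (k + 1)) (iterate p q A y μ x₀ s k) - y (s (k + 1))‖ ^ p := fun s n =>
    Finset.sum_nonneg fun k _ =>
      mul_nonneg (hμ _ (Nat.le_add_left 1 k)).le (Real.rpow_nonneg (norm_nonneg _) _)
  have hball : ∀ s n, ‖iterate p q A y μ x₀ s n - xdag‖ ≤ M := by
    intro s n
    have h1 := hlow (iterate p q A y μ x₀ s n) xdag _ (dualitySel_mem hpq.lt _)
    rw [← bregman_eq_fenchelGap hpq] at h1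
    have h2 := hbound s n
    have h3 := mul_nonneg hC0.le (hsumnn s n)
    have h4 : ‖iterate p q A y μ x₀ s n - xdag‖ ^ p ≤ D₀ / c := by
      rw [le_div_iff₀ hc]; linarith
    calc _ = (‖iterate p q A y μ x₀ s n - xdag‖ ^ p) ^ (1 / p) := by
          rw [← Real.rpow_mul (norm_nonneg _), mul_one_div_cancel hpq.ne_zero, Real.rpow_one]
      _ ≤ _ := Real.rpow_le_rpow (by positivity) h4 hpq.one_div_nonneg
  -- Both `J_p(x₀)` and `J_p(x†)` are approximated by the range of the adjoint.
  have hdag : dualitySel p xdag ∈ closure (adjointRange A) :=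
    mem_closure_adjointRange (hconv.surjective_inclusionInDoubleDual hpq hp) A
      fun h hh => hxdag.dualitySel_apply_eq_zero hpq.lt hsm hh
  have hdiff : dualitySel p x₀ - dualitySel p xdag ∈ closure (adjointRange A) := by
    rw [← coe_adjointRangeSubmodule, ← Submodule.topologicalClosure_coe] at hx₀ hdag ⊢
    exact Submodule.sub_mem _ hx₀ hdag
  obtain ⟨_, ⟨ψ, rfl⟩, hψ⟩ := (SeminormedAddCommGroup.mem_closure_iff
    (E := StrongDual ℝ X)).1 hdiff (ε / (M + 1)) (by positivity)
  refine ⟨(D₀ / C) ^ (1 / q) + ‖ψ‖, by positivity, fun s n => ?_⟩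
  set x := iterate p q A y μ x₀ s n with hx
  set S := ∑ l ∈ Finset.Icc 1 n, μ l with hS
  have hS0 : 0 ≤ S := Finset.sum_nonneg fun l hl => (hμ l (Finset.mem_Icc.1 hl).1).le
  set R := residual A y x with hR
  have hR0 : 0 ≤ R := residual_nonneg A y x
  have h1 : bregman p x xdag ≤ (dualitySel p x - dualitySel p xdag) (x - xdag) := by
    rw [← fenchelGap_add_fenchelGap hpq (dualitySel_mem hpq.lt x) (dualitySel_mem hpq.lt xdag),
      bregman_eq_fenchelGap hpq]
    linarith [fenchelGap_nonneg hpq (dualitySel p xdag) x]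
  set ζ := ∑ k ∈ Finset.range n,
    μ (k + 1) • direction p A (iterate p q A y μ x₀ s k) y (s (k + 1)) with hζ
  have h2 : dualitySel p x - dualitySel p xdag
      = (dualitySel p x₀ - dualitySel p xdag - ψ.comp A) + ψ.comp A - ζ := by
    rw [hx, dualitySel_iterate hpq hp hconv hsm]; abel
  have h3 : (dualitySel p x₀ - dualitySel p xdag - ψ.comp A) (x - xdag) ≤ ε := by
    calc _ ≤ ‖dualitySel p x₀ - dualitySel p xdag - ψ.comp A‖ * ‖x - xdag‖ :=
          (Real.le_norm_self _).trans (ContinuousLinearMap.le_opNorm _ _)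
      _ ≤ ε / (M + 1) * M := mul_le_mul hψ.le (hball s n) (norm_nonneg _) (by positivity)
      _ ≤ ε := by
        rw [div_mul_eq_mul_div, div_le_iff₀ (by positivity)]
        nlinarith
  have h4 : (ψ.comp A) (x - xdag) ≤ ‖ψ‖ * R := by
    rw [ContinuousLinearMap.comp_apply, map_sub A, hsolve]
    refine (le_abs_self _).trans ((ψ.le_opNorm _).trans ?_)
    gcongr
    exact norm_sub_le_residual A y x
  have h5 : -(ζ (x - xdag)) ≤ S ^ (1 / p) * (D₀ / C) ^ (1 / q) * R := by
    have h6 : -(ζ (x - xdag)) ≤ (∑ k ∈ Finset.range n, μ (k + 1) *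
        ‖component A (s (k + 1)) (iterate p q A y μ x₀ s k) - y (s (k + 1))‖ ^ (p - 1)) * R := by
      rw [hζ, sum_apply, ← Finset.sum_neg_distrib, Finset.sum_mul]
      refine Finset.sum_le_sum fun k _ => ?_
      rw [smul_apply, direction_apply, smul_eq_mul, ← mul_neg, mul_assoc]
      refine mul_le_mul_of_nonneg_left ?_ (hμ _ (Nat.le_add_left 1 k)).le
      refine (neg_le_abs _).trans
        (((dualitySel p (component A (s (k + 1)) (iterate p q A y μ x₀ s k)
          - y (s (k + 1)))).le_opNorm _).trans ?_)
      rw [norm_dualitySel hpq.lt]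
      gcongr
      rw [map_sub, component_apply A _ xdag, hsolve]
      exact norm_component_le_residual A y x _
    refine h6.trans (mul_le_mul_of_nonneg_right ?_ hR0)
    refine sum_mul_rpow_le hpq hμ (a := fun k =>
      ‖component A (s (k + 1)) (iterate p q A y μ x₀ s k) - y (s (k + 1))‖)
      (fun _ => norm_nonneg _) n ?_
    rw [le_div_iff₀ hC0]
    linarith [hbound s n, bregman_nonneg hpq x xdag]
  rw [h2, sub_apply, add_apply] at h1
  have h7 : 0 ≤ (D₀ / C) ^ (1 / q) * R := by positivity
  have h8 : 0 ≤ ‖ψ‖ * (S ^ (1 / p) * R) := by positivity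
  linarith

end Pathwise

/-! ### Expectations over finitely many random indices -/

section Sampling

variable {N : ℕ} {Ω : Type*} [MeasurableSpace Ω] {P : Measure Ω} {i : ℕ → Ω → Fin N}

/-- The path of indices which follows `u` at the times `1, …, k` and is constant elsewhere. -/
def extendPrefix [NeZero N] (k : ℕ) (u : Finset.range k → Fin N) (n : ℕ) : Fin N :=
  if h : n - 1 ∈ Finset.range k then u ⟨n - 1, h⟩ else 0

theorem apply_extendPrefix [NeZero N] {α : Type*} {k : ℕ} {f : (ℕ → Fin N) → α}
    (hf : DependsOn f (Set.Icc 1 k)) (s : ℕ → Fin N) :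
    f (extendPrefix k fun j => s (j + 1)) = f s := by
  refine hf fun n hn => ?_
  have h1 : n - 1 ∈ Finset.range k := Finset.mem_range.2 (by have := hn.1; have := hn.2; omega)
  rw [extendPrefix, dif_pos h1]
  exact congrArg s (Nat.sub_add_cancel hn.1)

theorem measurable_prefix (hi : ∀ k, 1 ≤ k → Measurable (i k)) (k : ℕ) :
    Measurable fun (ω : Ω) (j : Finset.range k) => i (j + 1) ω :=
  measurable_pi_lambda _ fun _ => hi _ (Nat.le_add_left 1 _)

theorem integrable_path [NeZero N] [IsFiniteMeasure P] (hi : ∀ k, 1 ≤ k → Measurable (i k))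
    {k : ℕ} {f : (ℕ → Fin N) → ℝ} (hf : DependsOn f (Set.Icc 1 k)) :
    Integrable (fun ω => f fun n => i n ω) P := by
  have h : Integrable (fun u => f (extendPrefix k u))
      (P.map fun (ω : Ω) (j : Finset.range k) => i (j + 1) ω) := Integrable.of_finite
  refine (h.comp_measurable (measurable_prefix hi k)).congr (Eventually.of_forall fun ω => ?_)
  exact apply_extendPrefix hf fun n => i n ω

theorem integral_path [NeZero N] [IsFiniteMeasure P] (hi : ∀ k, 1 ≤ k → Measurable (i k))
    {k : ℕ} {f : (ℕ → Fin N) → ℝ} (hf : DependsOn f (Set.Icc 1 k)) :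
    ∫ ω, f (fun n => i n ω) ∂P
      = ∑ u, (P.map fun (ω : Ω) (j : Finset.range k) => i (j + 1) ω).real {u}
          * f (extendPrefix k u) := by
  have h : Integrable (fun u => f (extendPrefix k u))
      (P.map fun (ω : Ω) (j : Finset.range k) => i (j + 1) ω) := Integrable.of_finite
  have h1 := integral_fintype h
  rw [integral_map (measurable_prefix hi k).aemeasurable h.aestronglyMeasurable] at h1
  simp only [smul_eq_mul] at h1
  rw [← h1]
  exact integral_congr_ae (Eventually.of_forall fun ω =>
    (apply_extendPrefix hf fun n => i n ω).symm)

/-- The expectation of a function of finitely many indices is continuous in a parameter as soon as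
the function is so along each path. -/
theorem tendsto_integral_path [NeZero N] [IsFiniteMeasure P]
    (hi : ∀ k, 1 ≤ k → Measurable (i k)) {k : ℕ} {α : Type*} {l : Filter α}
    {f : α → (ℕ → Fin N) → ℝ} {g : (ℕ → Fin N) → ℝ}
    (hf : ∀ a, DependsOn (f a) (Set.Icc 1 k)) (hg : DependsOn g (Set.Icc 1 k))
    (hfg : ∀ s, Tendsto (fun a => f a s) l (𝓝 (g s))) :
    Tendsto (fun a => ∫ ω, f a (fun n => i n ω) ∂P) l (𝓝 (∫ ω, g (fun n => i n ω) ∂P)) := by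
  simp only [fun a => integral_path (P := P) hi (hf a), integral_path (P := P) hi hg]
  exact tendsto_finsetSum _ fun u _ => (hfg _).const_mul _

/-- Averaging over the next index, which is uniformly distributed and independent of the past. -/
theorem integral_next_index [NeZero N] [IsProbabilityMeasure P]
    (hi : ∀ k, 1 ≤ k → Measurable (i k)) (hindep : iIndepFun (fun k : ℕ => i (k + 1)) P)
    (hunif : ∀ k, 1 ≤ k → ∀ j : Fin N, P {ω | i k ω = j} = (N : ℝ≥0∞)⁻¹)
    {k : ℕ} {g : Fin N → (ℕ → Fin N) → ℝ} (hg : ∀ j, DependsOn (g j) (Set.Icc 1 k)) :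
    ∫ ω, g (i (k + 1) ω) (fun n => i n ω) ∂P
      = (N : ℝ)⁻¹ * ∑ j, ∫ ω, g j (fun n => i n ω) ∂P := by
  classical
  have hk : Measurable (i (k + 1)) := hi _ (Nat.le_add_left 1 k)
  set U := fun (ω : Ω) (j : Finset.range k) => i (j + 1) ω with hU
  have hUm : Measurable U := measurable_prefix hi k
  have hind : IndepFun (i (k + 1)) U P := by
    have h1 := hindep.indepFun_finset {k} (Finset.range k) (by simp)
      fun k => hi _ (Nat.le_add_left 1 k)
    exact h1.comp (φ := fun u : ({k} : Finset ℕ) → Fin N => u ⟨k, Finset.mem_singleton_self k⟩)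
      (ψ := id) (measurable_pi_apply _) measurable_id
  have hsplit : ∀ ω, g (i (k + 1) ω) (fun n => i n ω)
      = ∑ j, (if i (k + 1) ω = j then (1 : ℝ) else 0) * g j (fun n => i n ω) := fun ω => by
    simp [ite_mul]
  have hterm : ∀ j, ∫ ω, (if i (k + 1) ω = j then (1 : ℝ) else 0) * g j (fun n => i n ω) ∂P
      = (N : ℝ)⁻¹ * ∫ ω, g j (fun n => i n ω) ∂P := by
    intro j
    have hj : IndepFun (fun ω => if i (k + 1) ω = j then (1 : ℝ) else 0)
        (fun ω => g j (fun n => i n ω)) P := by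
      have h1 := hind.comp (φ := fun a : Fin N => if a = j then (1 : ℝ) else 0)
        (ψ := fun u => g j (extendPrefix k u)) Measurable.of_discrete Measurable.of_discrete
      have h2 : (fun u => g j (extendPrefix k u)) ∘ U = fun ω => g j (fun n => i n ω) :=
        funext fun ω => apply_extendPrefix (hg j) fun n => i n ω
      rwa [h2] at h1
    have hm : Measurable fun ω => if i (k + 1) ω = j then (1 : ℝ) else 0 :=
      (Measurable.of_discrete (f := fun a : Fin N => if a = j then (1 : ℝ) else 0)).comp hk
    rw [hj.integral_fun_mul_eq_mul_integral hm.aestronglyMeasurable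
      (integrable_path hi (hg j)).aestronglyMeasurable]
    congr 1
    have hset : MeasurableSet {ω | i (k + 1) ω = j} := hk (measurableSet_singleton j)
    have h3 : (fun ω => if i (k + 1) ω = j then (1 : ℝ) else 0)
        = {ω | i (k + 1) ω = j}.indicator 1 := by
      funext ω; simp [Set.indicator_apply]
    rw [h3, integral_indicator_one hset, measureReal_def, hunif _ (Nat.le_add_left 1 k)]
    simp
  simp only [hsplit]
  rw [integral_finsetSum, Finset.mul_sum]
  · exact Finset.sum_congr rfl fun j _ => hterm j
  · intro j _
    refine (integrable_path hi (hg j)).bdd_mul (c := 1) ?_ (Eventually.of_forall fun ω => ?_)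
    · exact ((Measurable.of_discrete (f := fun a : Fin N => if a = j then (1 : ℝ) else 0)).comp
        hk).aestronglyMeasurable
    · split_ifs <;> simp

end Sampling

/-! ### Convergence for exact data -/

/-- If `∑ μ_{k+1} a_k` converges while the partial sums `S_k` of `μ` diverge, then `S_k a_k` is
not bounded away from `0`, because `∑ μ_{k+1} / S_k ≥ ∑ log (S_{k+1} / S_k)` diverges. -/
theorem exists_sum_mul_lt {μ a : ℕ → ℝ} (hμ : ∀ k, 1 ≤ k → 0 < μ k)
    (hdiv : Tendsto (fun n : ℕ => ∑ l ∈ Finset.Icc 1 n, μ l) atTop atTop) (ha : ∀ k, 0 ≤ a k)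
    {M : ℝ} (hM : ∀ n, ∑ k ∈ Finset.range n, μ (k + 1) * a k ≤ M) {ε : ℝ} (hε : 0 < ε) (K : ℕ) :
    ∃ k ≥ K, (∑ l ∈ Finset.Icc 1 k, μ l) * a k < ε := by
  by_contra! hcon
  set S := fun n : ℕ => ∑ l ∈ Finset.Icc 1 n, μ l with hS
  have hsucc : ∀ n, S (n + 1) = S n + μ (n + 1) := fun n =>
    Finset.sum_Icc_succ_top (Nat.le_add_left 1 n) _
  have hpos : ∀ n, 1 ≤ n → 0 < S n := fun n hn =>
    Finset.sum_pos (fun l hl => hμ l (Finset.mem_Icc.1 hl).1) ⟨1, Finset.mem_Icc.2 ⟨le_rfl, hn⟩⟩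
  set K' := K + 1
  have hlog : ∀ n, K' ≤ n → ε * Real.log (S n) ≤
      ε * Real.log (S K') + ∑ k ∈ Finset.range n, μ (k + 1) * a k := by
    intro n hn
    induction n, hn using Nat.le_induction with
    | base =>
      have : 0 ≤ ∑ k ∈ Finset.range K', μ (k + 1) * a k :=
        Finset.sum_nonneg fun k _ => mul_nonneg (hμ _ (Nat.le_add_left 1 k)).le (ha k)
      linarith
    | succ n hn ih =>
      have hn1 : 1 ≤ n := (Nat.le_add_left 1 K).trans hn
      have hSn := hpos n hn1
      have hm := hμ (n + 1) (Nat.le_add_left 1 n)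
      have h1 : Real.log (S (n + 1)) ≤ Real.log (S n) + μ (n + 1) / S n := by
        have h2 := Real.log_le_sub_one_of_pos (div_pos (hpos (n + 1) (Nat.le_add_left 1 n)) hSn)
        rw [Real.log_div (hpos (n + 1) (Nat.le_add_left 1 n)).ne' hSn.ne', hsucc, add_div,
          div_self hSn.ne'] at h2
        rw [hsucc]
        linarith
      have h3 : ε * (μ (n + 1) / S n) ≤ μ (n + 1) * a n := by
        have h4 : ε ≤ S n * a n := hcon n ((Nat.le_succ K).trans hn)
        rw [← mul_div_assoc, div_le_iff₀ hSn]
        nlinarith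
      rw [Finset.sum_range_succ]
      nlinarith
  have hlim : Tendsto (fun n => ε * Real.log (S n)) atTop atTop :=
    (Real.tendsto_log_atTop.comp hdiv).const_mul_atTop hε
  obtain ⟨n, hn1, hn2⟩ := ((hlim.eventually (eventually_gt_atTop
    (ε * Real.log (S K') + M))).and (eventually_ge_atTop K')).exists
  have := hlog n hn2
  linarith [hM n]

section Exact

variable {X : Type*} [NormedAddCommGroup X] [NormedSpace ℝ X]
  {N : ℕ} {Y : Fin N → Type*} [∀ i, NormedAddCommGroup (Y i)] [∀ i, NormedSpace ℝ (Y i)]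
  {r : ℝ≥0∞} {p q : ℝ}

theorem dependsOn_comp_iterate {α : Type*} (f : X → α) (A : X →L[ℝ] PiLp r Y) (y : PiLp r Y)
    (μ : ℕ → ℝ) (x₀ : X) (n : ℕ) :
    DependsOn (fun s : ℕ → Fin N => f (iterate p q A y μ x₀ s n)) (Set.Icc 1 n) :=
  fun _ _ h => congrArg f (iterate_congr A y μ x₀ h)

variable [CompleteSpace X] [NeZero N]
  {Ω : Type*} [MeasurableSpace Ω] {P : Measure Ω} [IsProbabilityMeasure P] {i : ℕ → Ω → Fin N}

/-- For exact data, the expected residuals weighted by the step sizes are summable. -/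
theorem sum_mul_integral_residual_le (hpq : p.HolderConjugate q) (hp : 2 ≤ p)
    (hconv : IsPConvex X p) (hsm : IsUniformlySmooth X) (A : X →L[ℝ] PiLp r Y) {y : PiLp r Y}
    {w : X} (hw : A w = y) (x₀ : X)
    (hi : ∀ k, 1 ≤ k → Measurable (i k)) (hindep : iIndepFun (fun k : ℕ => i (k + 1)) P)
    (hunif : ∀ k, 1 ≤ k → ∀ j : Fin N, P {ω | i k ω = j} = (N : ℝ≥0∞)⁻¹)
    {C : ℝ} (hC0 : 0 < C) {μ : ℕ → ℝ} (hμ : ∀ k, 1 ≤ k → 0 < μ k)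
    (hC : ∀ k, 1 ≤ k →
      C < 1 - Lmax A ^ q * (bregmanConst (StrongDual ℝ X) q / q) * μ k ^ (q - 1)) (n : ℕ) :
    ∑ k ∈ Finset.range n, μ (k + 1) * ∑ j, ∫ ω,
        ‖component A j (iterate p q A y μ x₀ (fun n => i n ω) k) - y j‖ ^ p ∂P
      ≤ N * (bregman p x₀ w / C) := by
  have hN : (0 : ℝ) < N := Nat.cast_pos.2 (NeZero.pos N)
  have hdep : ∀ k j, DependsOn (fun s : ℕ → Fin N =>
      ‖component A j (iterate p q A y μ x₀ s k) - y j‖ ^ p) (Set.Icc 1 k) := fun k j =>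
    dependsOn_comp_iterate (fun x => ‖component A j x - y j‖ ^ p) A y μ x₀ k
  -- The sampled residual at step `k + 1` depends on the first `k + 1` indices.
  have hdep' : ∀ k, DependsOn (fun s : ℕ → Fin N =>
      ‖component A (s (k + 1)) (iterate p q A y μ x₀ s k) - y (s (k + 1))‖ ^ p)
      (Set.Icc 1 (k + 1)) := fun k s s' h => by
    have h1 := h (k + 1) ⟨Nat.le_add_left 1 k, le_rfl⟩
    have h2 : iterate p q A y μ x₀ s k = iterate p q A y μ x₀ s' k :=
      iterate_congr A y μ x₀ fun l hl => h l ⟨hl.1, hl.2.trans k.le_succ⟩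
    simp only [h2]
    exact congrArg
      (fun j => ‖component A j (iterate p q A y μ x₀ s' k) - y j‖ ^ p) h1
  have hint : ∀ k, Integrable (fun ω => μ (k + 1) * ‖component A (i (k + 1) ω)
      (iterate p q A y μ x₀ (fun n => i n ω) k) - y (i (k + 1) ω)‖ ^ p) P := fun k =>
    (integrable_path hi (hdep' k)).const_mul _
  have hpath : ∀ ω, ∑ k ∈ Finset.range n, μ (k + 1) * ‖component A (i (k + 1) ω)
      (iterate p q A y μ x₀ (fun n => i n ω) k) - y (i (k + 1) ω)‖ ^ p
      ≤ bregman p x₀ w / C := fun ω => by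
    rw [le_div_iff₀ hC0]
    have h1 := bregman_iterate_add_le hpq hp hconv hsm A hw hμ hC x₀ (fun n => i n ω) n
    linarith [bregman_nonneg hpq (iterate p q A y μ x₀ (fun n => i n ω) n) w]
  have hmean := integral_mono (μ := P) (integrable_finsetSum _ fun k _ => hint k)
    (integrable_const (bregman p x₀ w / C)) hpath
  rw [integral_finsetSum _ fun k _ => hint k, integral_const, probReal_univ, one_smul] at hmean
  have hterm : ∀ k, ∫ ω, μ (k + 1) * ‖component A (i (k + 1) ω)
      (iterate p q A y μ x₀ (fun n => i n ω) k) - y (i (k + 1) ω)‖ ^ p ∂P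
      = (N : ℝ)⁻¹ * (μ (k + 1) * ∑ j, ∫ ω,
        ‖component A j (iterate p q A y μ x₀ (fun n => i n ω) k) - y j‖ ^ p ∂P) := fun k => by
    rw [integral_const_mul, integral_next_index hi hindep hunif (hdep k)]
    ring
  simp only [hterm] at hmean
  rw [← Finset.mul_sum, inv_mul_le_iff₀ hN] at hmean
  exact hmean

variable [Fact (1 ≤ r)]

/-- For exact data the expected Bregman distance to the minimum norm solution is not bounded away
from `0`: it is small whenever the expected residual is small compared to the sum of the step
sizes. -/
theorem exists_integral_bregman_lt (hpq : p.HolderConjugate q) (hp : 2 ≤ p)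
    (hconv : IsPConvex X p) (hsm : IsUniformlySmooth X) (A : X →L[ℝ] PiLp r Y) {y : PiLp r Y}
    {xdag : X} (hxdag : IsMinNormSolution A y xdag) {x₀ : X}
    (hx₀ : dualitySel p x₀ ∈ closure (adjointRange A))
    (hi : ∀ k, 1 ≤ k → Measurable (i k)) (hindep : iIndepFun (fun k : ℕ => i (k + 1)) P)
    (hunif : ∀ k, 1 ≤ k → ∀ j : Fin N, P {ω | i k ω = j} = (N : ℝ≥0∞)⁻¹)
    {C : ℝ} (hC0 : 0 < C) {μ : ℕ → ℝ} (hμ : ∀ k, 1 ≤ k → 0 < μ k)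
    (hdiv : Tendsto (fun n : ℕ => ∑ l ∈ Finset.Icc 1 n, μ l) atTop atTop)
    (hC : ∀ k, 1 ≤ k →
      C < 1 - Lmax A ^ q * (bregmanConst (StrongDual ℝ X) q / q) * μ k ^ (q - 1))
    {ε : ℝ} (hε : 0 < ε) :
    ∃ n, ∫ ω, bregman p (iterate p q A y μ x₀ (fun n => i n ω) n) xdag ∂P < ε := by
  have hp0 : 0 < p := hpq.pos
  obtain ⟨B, hB, hbreg⟩ := exists_bregman_iterate_le hpq hp hconv hsm A hxdag hx₀ hC0 hμ hC
    (show 0 < ε / 4 by positivity)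
  set θ := ε / (8 * (B + 1)) with hθ
  have hθ0 : 0 < θ := by positivity
  have hBθ : 2 * B * θ ≤ ε / 4 := by
    rw [hθ, ← mul_div_assoc, div_le_iff₀ (by positivity)]
    nlinarith
  set T := 2 * B * θ ^ (1 - p) * (N : ℝ) ^ (p - 1) with hT
  have hT0 : 0 ≤ T := by positivity
  obtain ⟨n₁, hn₁⟩ := (hdiv.eventually (eventually_ge_atTop (1 : ℝ))).exists_forall_of_atTop
  set b := fun k => ∑ j, ∫ ω,
    ‖component A j (iterate p q A y μ x₀ (fun n => i n ω) k) - y j‖ ^ p ∂P with hb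
  have hb0 : ∀ k, 0 ≤ b k := fun k => Finset.sum_nonneg fun j _ =>
    integral_nonneg fun ω => Real.rpow_nonneg (norm_nonneg _) _
  obtain ⟨n, hn, hSb⟩ := exists_sum_mul_lt (a := b) hμ hdiv hb0
    (sum_mul_integral_residual_le hpq hp hconv hsm A hxdag.1 x₀ hi hindep hunif hC0 hμ hC)
    (show 0 < ε / (4 * (T + 1)) by positivity) n₁
  refine ⟨n, ?_⟩
  have hS1 := hn₁ n hn
  set S := ∑ l ∈ Finset.Icc 1 n, μ l with hS
  have hS0 : 0 ≤ S := zero_le_one.trans hS1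
  have hTS : T * (S * b n) ≤ ε / 4 := by
    calc T * (S * b n) ≤ T * (ε / (4 * (T + 1))) := by gcongr
      _ ≤ ε / 4 := by
        rw [← mul_div_assoc, div_le_iff₀ (by positivity)]
        nlinarith
  have hdep : ∀ j, DependsOn (fun s : ℕ → Fin N =>
      ‖component A j (iterate p q A y μ x₀ s n) - y j‖ ^ p) (Set.Icc 1 n) := fun j =>
    dependsOn_comp_iterate (fun x => ‖component A j x - y j‖ ^ p) A y μ x₀ n
  have hint : ∀ j, Integrable (fun ω =>
      ‖component A j (iterate p q A y μ x₀ (fun n => i n ω) n) - y j‖ ^ p) P := fun j =>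
    integrable_path hi (hdep j)
  have hpt : ∀ ω, bregman p (iterate p q A y μ x₀ (fun n => i n ω) n) xdag ≤
      ε / 2 + T * S * ∑ j,
        ‖component A j (iterate p q A y μ x₀ (fun n => i n ω) n) - y j‖ ^ p := by
    intro ω
    have h1 := hbreg (fun n => i n ω) n
    set x := iterate p q A y μ x₀ (fun n => i n ω) n
    set R := residual A y x with hR
    have hR0 : 0 ≤ R := residual_nonneg A y x
    have hS1p : 1 ≤ S ^ (1 / p) := Real.one_le_rpow hS1 (by positivity)
    have h2 := mul_le_mul_rpow_add_mul_rpow hpq.symm hθ0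
      (by positivity : 0 ≤ S ^ (1 / p) * R) zero_le_one
    rw [Real.one_rpow, mul_one, mul_one, Real.mul_rpow (by positivity) hR0,
      ← Real.rpow_mul hS0, one_div_mul_cancel hpq.ne_zero, Real.rpow_one] at h2
    have h3 := residual_rpow_le (by linarith : 1 ≤ p) A y x
    have h4 : (1 + S ^ (1 / p)) * R ≤ 2 * (S ^ (1 / p) * R) := by nlinarith
    have h5 : θ ^ (1 - p) * (S * R ^ p) ≤ θ ^ (1 - p) * (S * ((N : ℝ) ^ (p - 1)
        * ∑ j, ‖component A j x - y j‖ ^ p)) := by gcongr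
    have h6 : B * ((1 + S ^ (1 / p)) * R) ≤ B * (2 * (θ + θ ^ (1 - p) * (S * ((N : ℝ) ^ (p - 1)
        * ∑ j, ‖component A j x - y j‖ ^ p)))) :=
      mul_le_mul_of_nonneg_left (by linarith) hB
    rw [hT]
    linarith
  have hmean := integral_mono (μ := P)
    (integrable_path hi (dependsOn_comp_iterate (fun x => bregman p x xdag) A y μ x₀ n))
    ((integrable_const (ε / 2)).add ((integrable_finsetSum _ fun j _ => hint j).const_mul (T * S)))
    hpt
  simp only [Pi.add_apply] at hmean
  rw [integral_add (integrable_const _) ((integrable_finsetSum _ fun j _ => hint j).const_mul _),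
    integral_const, probReal_univ, one_smul, integral_const_mul,
    integral_finsetSum _ fun j _ => hint j, mul_assoc] at hmean
  change _ ≤ ε / 2 + T * (S * b n) at hmean
  linarith

end Exact

end BanachSGD

end

theorem theorem4p2
    {X : Type*} [NormedAddCommGroup X] [NormedSpace ℝ X] [CompleteSpace X]
    {N : ℕ} [NeZero N]
    {Y : Fin N → Type*} [∀ i, NormedAddCommGroup (Y i)] [∀ i, NormedSpace ℝ (Y i)]
    [∀ i, CompleteSpace (Y i)]
    {r : ℝ≥0∞} [Fact (1 ≤ r)]
    -- conjugate exponents; `q` is `p*`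
    {p q : ℝ} (hpq : p.HolderConjugate q) (hp : 2 ≤ p)
    -- geometry of the spaces
    (hX_convex : BanachSGD.IsPConvex X p)
    (hX_smooth : BanachSGD.IsUniformlySmooth X)
    (hY_smooth : ∀ i, BanachSGD.IsUniformlySmooth (Y i))
    -- the operator, the exact data, the minimum norm solution, the initial guess
    (A : X →L[ℝ] PiLp r Y) (y : PiLp r Y)
    (xdag : X) (hxdag : BanachSGD.IsMinNormSolution A y xdag)
    (x₀ : X) (hx₀ : BanachSGD.dualitySel p x₀ ∈ closure (BanachSGD.adjointRange A))
    -- noisy data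
    (yδ : ℝ → PiLp r Y) (hyδ : ∀ δ : ℝ, 0 < δ → ‖yδ δ - y‖ ≤ δ)
    -- the random indices `i_1, i_2, …`: independent, uniform on `{1, …, N}`
    {Ω : Type*} [MeasurableSpace Ω] (P : Measure Ω) [IsProbabilityMeasure P]
    (i : ℕ → Ω → Fin N) (hi_meas : ∀ k, 1 ≤ k → Measurable (i k))
    (hi_indep : iIndepFun (fun k : ℕ => i (k + 1)) P)
    (hi_unif : ∀ k, 1 ≤ k → ∀ j : Fin N, P {ω | i k ω = j} = (N : ℝ≥0∞)⁻¹)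
    -- the step sizes `μ_1, μ_2, …`
    (μ : ℕ → ℝ) (hμ_pos : ∀ k, 1 ≤ k → 0 < μ k)
    (hμ_div : Tendsto (fun n : ℕ => ∑ l ∈ Finset.Icc 1 n, μ l) atTop atTop)
    (hμ_sum : Summable fun k : ℕ => μ (k + 1) ^ q)
    (C : ℝ) (hC : 0 < C)
    (hμ_bound : ∀ k, 1 ≤ k →
      C < 1 - BanachSGD.Lmax A ^ q * (BanachSGD.bregmanConst (StrongDual ℝ X) q / q)
        * μ k ^ (q - 1))
    -- the stopping indices
    (k : ℝ → ℕ) (hk : Tendsto k (𝓝[>] 0) atTop)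
    (hkμ : Tendsto (fun δ : ℝ => δ ^ p * ∑ l ∈ Finset.Icc 1 (k δ), μ l) (𝓝[>] 0) (𝓝 0)) :
    (∀ δ : ℝ, 0 < δ → Integrable (fun ω => BanachSGD.bregman p
      (BanachSGD.iterate p q A (yδ δ) μ x₀ (fun n => i n ω) (k δ)) xdag) P) ∧
    Tendsto (fun δ : ℝ => ∫ ω, BanachSGD.bregman p
      (BanachSGD.iterate p q A (yδ δ) μ x₀ (fun n => i n ω) (k δ)) xdag ∂P)
      (𝓝[>] 0) (𝓝 0) := by
  have hdep : ∀ (y' : PiLp r Y) (n : ℕ), DependsOn (fun s : ℕ → Fin N =>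
      BanachSGD.bregman p (BanachSGD.iterate p q A y' μ x₀ s n) xdag) (Set.Icc 1 n) := fun y' n =>
    BanachSGD.dependsOn_comp_iterate (fun x => BanachSGD.bregman p x xdag) A y' μ x₀ n
  have hint : ∀ (y' : PiLp r Y) (n : ℕ), Integrable (fun ω => BanachSGD.bregman p
      (BanachSGD.iterate p q A y' μ x₀ (fun n => i n ω) n) xdag) P := fun y' n =>
    BanachSGD.integrable_path hi_meas (hdep y' n)
  refine ⟨fun δ _ => hint _ _, Metric.tendsto_nhds.2 fun ε hε => ?_⟩
  obtain ⟨m, hm⟩ := BanachSGD.exists_integral_bregman_lt hpq hp hX_convex hX_smooth A hxdag hx₀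
    hi_meas hi_indep hi_unif hC hμ_pos hμ_div hμ_bound (half_pos hε)
  have hdata : Tendsto yδ (𝓝[>] 0) (𝓝 y) := by
    rw [tendsto_iff_norm_sub_tendsto_zero]
    refine squeeze_zero' (Eventually.of_forall fun _ => norm_nonneg _) ?_
      (tendsto_id.mono_left nhdsWithin_le_nhds)
    filter_upwards [self_mem_nhdsWithin] with δ hδ using hyδ δ hδ
  have hstable : Tendsto (fun δ => ∫ ω, BanachSGD.bregman p
      (BanachSGD.iterate p q A (yδ δ) μ x₀ (fun n => i n ω) m) xdag ∂P) (𝓝[>] 0)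
      (𝓝 (∫ ω, BanachSGD.bregman p
        (BanachSGD.iterate p q A y μ x₀ (fun n => i n ω) m) xdag ∂P)) :=
    BanachSGD.tendsto_integral_path hi_meas (fun δ => hdep (yδ δ) m) (hdep y m) fun s =>
      (((BanachSGD.continuous_bregman_left hpq.lt hX_smooth xdag).comp
        (BanachSGD.continuous_iterate hpq hp hX_convex hX_smooth hY_smooth A μ x₀ s m)).tendsto
          y).comp hdata
  have hnoise : Tendsto (fun δ => C ^ (1 - p) * (δ ^ p * ∑ l ∈ Finset.Icc 1 (k δ), μ l))
      (𝓝[>] 0) (𝓝 0) := by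
    simpa using hkμ.const_mul (C ^ (1 - p))
  filter_upwards [self_mem_nhdsWithin, hstable.eventually (gt_mem_nhds hm),
    hnoise.eventually (gt_mem_nhds (half_pos hε)), hk.eventually (eventually_ge_atTop m)]
    with δ hδ h1 h2 h3
  have hδ0 : (0 : ℝ) < δ := hδ
  have hmean := integral_mono (μ := P) (hint (yδ δ) (k δ))
    ((hint (yδ δ) m).add (integrable_const
      (C ^ (1 - p) * (δ ^ p * ∑ l ∈ Finset.Icc 1 (k δ), μ l))))
    fun ω => BanachSGD.bregman_iterate_le_of_noise hpq hp hX_convex hX_smooth A hxdag.1 hC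
      hδ0.le (hyδ δ hδ0) hμ_pos hμ_bound x₀ (fun n => i n ω) h3
  simp only [Pi.add_apply] at hmean
  rw [integral_add (hint _ _) (integrable_const _), integral_const, probReal_univ,
    one_smul] at hmean
  rw [Real.dist_0_eq_abs, abs_of_nonneg (integral_nonneg fun ω =>
    BanachSGD.bregman_nonneg hpq _ _)]
  linarith
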